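/- Let $p$ be a prime, let $K$ be a finite extension of $\mathbb{Q}_p$ with ring of integers $\mathcal{O}_K$ and residue field $k$, let $G$ be a compact $p$-adic analytic group, and let $H$ be an open normal subgroup of $G$ that is a uniform pro-$p$ group (for instance a maximal such subgroup). Let $\mathcal{O}_K[[G]]=\varprojlim_N \mathcal{O}_K[G/N]$, where $N$ runs over the open normal subgroups of $G$, be the completed group algebra. Assume that $K$ is a splitting field for the finite group $G/H$, i.e. $\mathrm{End}_{K[G/H]}(V)=K$ for every simple $K[G/H]$-module $V$. Let $c$ be the number of conjugacy classes of $G/H$ whose elements have order relatively prime to $p$. For a ring $R$ let $K_0(R)$ be the abelian group with one generator $[P]$ for each finitely generated projective $R$-module $P$ and one relation $[P]=[P_1]+[P_2]$ for each short exact sequence $0\to P_1\to P\to P_2\to 0$ of such modules. Then: 1. The augmentation map $\varphi:\mathcal{O}_K[[G]]\to k[G/H]$ (projection to $\mathcal{O}_K[G/H]$ followed by reduction of the coefficients) is surjective, and its kernel $I$ is contained in the Jacobson radical of $\mathcal{O}_K[[G]]$. 2. Every finitely generated projective $k[G/H]$-module is isomorphic to $P/IP$ for some finitely generated projective $\mathcal{O}_K[[G]]$-module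 $P$, and $[P]\mapsto[P/IP]$ defines an isomorphism $K_0(\mathcal{O}_K[[G]])\cong K_0(k[G/H])$. 3. $K_0(k[G/H])\cong\mathbb{Z}^c$, and hence $K_0(\mathcal{O}_K[[G]])\cong\mathbb{Z}^c$. -/

import Mathlib

universe u v w

open scoped Manifold ContDiff

/-! ### `p`-adic analytic groups and uniform pro-`p` groups -/

/-- A topological group is `p`-adic analytic if it carries a structure of (finite-dimensional)
analytic manifold over `ℚ_p`, compatible with its topology, for which multiplication and inversion
are analytic (`ω` is analyticity). -/
def IsPadicAnalyticGroup (p : ℕ) [Fact p.Prime] (G : Type v) [Group G] [TopologicalSpace G] :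
    Prop :=
  ∃ (d : ℕ) (_ : ChartedSpace (Fin d → ℚ_[p]) G), LieGroup 𝓘(ℚ_[p], Fin d → ℚ_[p]) ω G

/-- A pro-`p` group: a profinite group all of whose open normal subgroups have `p`-power index. -/
structure IsProP (p : ℕ) (P : Type v) [Group P] [TopologicalSpace P] : Prop where
  isTopologicalGroup : IsTopologicalGroup P
  compactSpace : CompactSpace P
  t2Space : T2Space P
  totallyDisconnectedSpace : TotallyDisconnectedSpace P
  index_eq : ∀ N : OpenNormalSubgroup P, ∃ n : ℕ, N.toSubgroup.index = p ^ n

/-- The lower `p`-series of a topological group, indexed from `0`: the zeroth term is the whole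
group `P`, and the term after `Q` is the closure of `Q ^ p [Q, P]`. -/
def lowerPSeries (p : ℕ) (P : Type v) [Group P] [TopologicalSpace P] [IsTopologicalGroup P] :
    ℕ → Subgroup P
  | 0 => ⊤
  | n + 1 =>
      (Subgroup.closure
        ({x | ∃ a ∈ lowerPSeries p P n, x = a ^ p} ∪
          {x | ∃ a ∈ lowerPSeries p P n, ∃ g : P, x = a * g * a⁻¹ * g⁻¹})).topologicalClosure

/-- A group is powerful if its quotient by the closed subgroup generated by the `p`-th powers (the
fourth powers if `p = 2`) is abelian, that is, if this subgroup contains all commutators. -/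
def IsPowerful (p : ℕ) (P : Type v) [Group P] [TopologicalSpace P] [IsTopologicalGroup P] : Prop :=
  ∀ x y : P, x * y * x⁻¹ * y⁻¹ ∈
    (Subgroup.closure {z : P | ∃ a : P, z = a ^ (if p = 2 then 4 else p)}).topologicalClosure

/-- A uniform pro-`p` group: a topologically finitely generated, powerful pro-`p` group all of
whose successive indices in the lower `p`-series agree. -/
structure IsUniformProP (p : ℕ) (P : Type v) [Group P] [TopologicalSpace P]
    [IsTopologicalGroup P] : Prop where
  isProP : IsProP p P
  finitelyGenerated : ∃ S : Finset P, (Subgroup.closure (S : Set P)).topologicalClosure = ⊤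
  powerful : IsPowerful p P
  relIndex_eq : ∀ n : ℕ,
    (lowerPSeries p P (n + 1)).relIndex (lowerPSeries p P n) =
      (lowerPSeries p P 1).relIndex (lowerPSeries p P 0)

/-! ### Finite groups: splitting fields and `p`-regular classes -/

/-- `F` is a splitting field for the group `A`: each endomorphism of each simple `F[A]`-module is
multiplication by an element of `F`. Every simple `F[A]`-module is a quotient of `F[A]`, so it is
enough to look at modules in the universe of `F[A]`. -/
def IsSplittingFieldFor (F : Type u) [Field F] (A : Type v) [Group A] : Prop :=
  ∀ (V : Type max u v) [AddCommGroup V] [Module (MonoidAlgebra F A) V]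
    [IsSimpleModule (MonoidAlgebra F A) V] (f : V →ₗ[MonoidAlgebra F A] V),
    ∃ c : F, ∀ x : V, f x = algebraMap F (MonoidAlgebra F A) c • x

/-- The number of conjugacy classes of `A` whose elements have order relatively prime to `p`. -/
noncomputable def numPRegularClasses (p : ℕ) (A : Type v) [Group A] : ℕ :=
  Nat.card {C : ConjClasses A // ∀ a ∈ C.carrier, (orderOf a).Coprime p}

/-! ### The ring of integers and completed group algebras -/

/-- The ring of integers `{x | ‖x‖ ≤ 1}` of a nonarchimedean normed field. -/
noncomputable abbrev IntegerRing (K : Type u) [NormedField K] [IsUltrametricDist K] : ValuationSubring K :=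
  (NormedField.valuation (K := K)).valuationSubring

/-- The residue field of the ring of integers. -/
abbrev IntegerResidueField (K : Type u) [NormedField K] [IsUltrametricDist K] : Type u :=
  IsLocalRing.ResidueField (IntegerRing K)

/-- The completed group algebra `A[[G]]`: the inverse limit of the group algebras `A[G/N]` over the
open normal subgroups `N` of `G`, realised as the ring of compatible families. -/
def CompletedGroupAlgebra (A : Type u) [CommRing A] (G : Type v) [Group G] [TopologicalSpace G] :
    Subring (∀ N : OpenNormalSubgroup G, MonoidAlgebra A (G ⧸ N.toSubgroup)) where
  carrier := {x | ∀ (N M : OpenNormalSubgroup G) (h : N.toSubgroup ≤ M.toSubgroup),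
    MonoidAlgebra.mapDomainRingHom A
      (QuotientGroup.map N.toSubgroup M.toSubgroup (MonoidHom.id G) h) (x N) = x M}
  zero_mem' := fun N M h => by simp
  one_mem' := fun N M h => by simp only [Pi.one_apply, map_one]
  add_mem' := fun hx hy N M h => by simp only [Pi.add_apply, map_add, hx N M h, hy N M h]
  mul_mem' := fun hx hy N M h => by simp only [Pi.mul_apply, map_mul, hx N M h, hy N M h]
  neg_mem' := fun hx N M h => by simp only [Pi.neg_apply, map_neg, hx N M h]

/-- The augmentation map `A[[G]] → k[G/H]` of a local ring `A` with residue field `k`: project to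
`A[G/H]` and reduce the coefficients. -/
noncomputable def augmentationMap (A : Type u) [CommRing A] [IsLocalRing A] {G : Type v} [Group G]
    [TopologicalSpace G] (H : OpenNormalSubgroup G) :
    CompletedGroupAlgebra A G →+* MonoidAlgebra (IsLocalRing.ResidueField A) (G ⧸ H.toSubgroup) :=
  (MonoidAlgebra.mapRingHom (G ⧸ H.toSubgroup) (IsLocalRing.residue A)).comp
    ((Pi.evalRingHom (fun N : OpenNormalSubgroup G => MonoidAlgebra A (G ⧸ N.toSubgroup)) H).comp
      (CompletedGroupAlgebra A G).subtype)

/-! ### The Grothendieck group of a ring -/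

/-- A finitely generated projective (left) module over `R`. Each of them is isomorphic to one in
the universe of `R`. -/
structure FGProjective (R : Type w) [Ring R] : Type (w + 1) where
  carrier : Type w
  [addCommGroup : AddCommGroup carrier]
  [module : Module R carrier]
  [finite : Module.Finite R carrier]
  [projective : Module.Projective R carrier]

attribute [instance] FGProjective.addCommGroup FGProjective.module FGProjective.finite
  FGProjective.projective

/-- The elements `[P] - [P₁] - [P₂]` for the short exact sequences `0 → P₁ → P → P₂ → 0` of
finitely generated projective modules. -/
def K0Relations (R : Type w) [Ring R] : Set (FreeAbelianGroup (FGProjective R)) :=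
  {x | ∃ (P₁ P P₂ : FGProjective R) (f : P₁.carrier →ₗ[R] P.carrier)
      (g : P.carrier →ₗ[R] P₂.carrier),
    Function.Injective f ∧ Function.Exact f g ∧ Function.Surjective g ∧
      x = FreeAbelianGroup.of P - FreeAbelianGroup.of P₁ - FreeAbelianGroup.of P₂}

/-- The Grothendieck group `K₀(R)`: one generator for each finitely generated projective module and
one relation `[P] = [P₁] + [P₂]` for each short exact sequence `0 → P₁ → P → P₂ → 0`. -/
abbrev K0 (R : Type w) [Ring R] : Type (w + 1) :=
  FreeAbelianGroup (FGProjective R) ⧸ AddSubgroup.closure (K0Relations R)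

/-- The class `[P]` in `K₀(R)`. -/
def K0.mk {R : Type w} [Ring R] (P : FGProjective R) : K0 R :=
  QuotientAddGroup.mk (FreeAbelianGroup.of P)

/-- For a surjective ring homomorphism `φ : R → S` with kernel `I`: the `S`-module `Q` is the
reduction `P / I P` (that is, `S ⊗_R P`) of the `R`-module `P`, via some `φ`-semilinear surjection
`P → Q` with kernel `I P`. -/
def IsReduction {R : Type w} {S : Type v} [Ring R] [Ring S] (φ : R →+* S) (P : FGProjective R)
    (Q : FGProjective S) : Prop :=
  ∃ π : P.carrier →ₛₗ[φ] Q.carrier, Function.Surjective π ∧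
    ∀ x : P.carrier, π x = 0 ↔
      x ∈ Submodule.span R {y | ∃ a ∈ RingHom.ker φ, ∃ z : P.carrier, y = a • z}

/-! Write `Λ` for the completed group algebra, `A = G/H`, and `q` for the cardinality of the residue
field `k`. The comparison of Grothendieck groups needs two facts about the surjection `Λ → k[A]`:
its kernel lies in the Jacobson radical, so that by Nakayama a projective module is determined by
its reduction, and idempotent matrices lift, so that every projective `k[A]`-module is a reduction
(`K0.exists_equiv_of_reduction`). For the kernel, consider a finite level `G/N` with `N ≤ H`: on a
simple module the maximal ideal acts by zero (Nakayama), and the normal `p`-subgroup `H/N` acts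
trivially (a `p`-group has a nonzero fixed point in a finite module killed by `p`). Elements `1 + w`
with `w` in the kernel are then units at every level, and their inverses are compatible. For
lifting, `Λ` is compact, so the fibre over an idempotent matrix is a compact semigroup, which
contains an idempotent.

The same comparison, applied to `k[A]` modulo its radical, reduces the computation of `K₀(k[A])` to
a product of matrix rings over finite fields `D i`, where `K₀` is free on the column modules. It
remains to count the factors. The traces of representatives of the `p`-regular classes form a
`k`-basis of the product of the `D i`, and every `D i` equals `k`, provided that each `p`-regular
`g` is conjugate to `g ^ q` (`card_eq_numPRegularClasses`). This last fact comes from characteristic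
zero (`IsSplittingFieldFor.isConj_pow`): a Frobenius automorphism over `K` raises roots of unity of
order prime to `p` to the power `q` and fixes character values, so `g` and `g ^ q` have equal
characters, and over a splitting field these separate classes. -/

/-! ### Reduction of projective modules along a surjective ring homomorphism -/

namespace FGProjective

variable {R : Type w} [Ring R]

/-- The class of a finitely generated projective module. -/
def ofModule (R : Type w) [Ring R] (M : Type w) [AddCommGroup M] [Module R M] [Module.Finite R M]
    [Module.Projective R M] : FGProjective R := ⟨M⟩

/-- The direct sum of two finitely generated projective modules. -/
def prod (P Q : FGProjective R) : FGProjective R := ofModule R (P.carrier × Q.carrier)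

/-- The coordinates of a finitely generated projective module. -/
theorem exists_coordinates (P : FGProjective R) :
    ∃ (n : ℕ) (i : P.carrier →ₗ[R] (Fin n → R)) (s : (Fin n → R) →ₗ[R] P.carrier)
      (E : Matrix (Fin n) (Fin n) R), (∀ x, s (i x) = x) ∧ E * E = E ∧
        ∀ v, i (s v) = Matrix.vecMul v E := by
  obtain ⟨n, s, hs⟩ := Module.Finite.exists_fin' R P.carrier
  obtain ⟨i, hi⟩ := Module.projective_lifting_property s LinearMap.id hs
  have hsi : ∀ x, s (i x) = x := fun x => LinearMap.congr_fun hi x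
  -- Endomorphisms of the left module `R ^ n` are right multiplications on row vectors, hence
  -- `vecMul`, which is compatible with a noncommutative `R`.
  have hE : ∀ v, i (s v) = Matrix.vecMul v (Matrix.of fun a => i (s (Pi.single a 1))) := by
    intro v
    conv_lhs => rw [pi_eq_sum_univ' v]
    simp only [map_sum, map_smul]
    ext j
    simp [Matrix.vecMul, dotProduct]
  refine ⟨n, i, s, Matrix.of fun a => i (s (Pi.single a 1)), hsi, ?_, hE⟩
  refine Matrix.ext_iff_vecMul.2 fun v => ?_
  rw [← Matrix.vecMul_vecMul, ← hE, ← hE, hsi]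

end FGProjective

/-- The row space of an idempotent matrix. -/
def idempotentRowSpace {R : Type w} [Ring R] {n : ℕ} (E : Matrix (Fin n) (Fin n) R)
    (hE : E * E = E) : FGProjective R :=
  have hv : ∀ x : LinearMap.range E.vecMulLinear, Matrix.vecMul (x : Fin n → R) E = x := by
    rintro ⟨_, v, rfl⟩
    simp [Matrix.vecMul_vecMul, hE]
  haveI : Module.Projective R (LinearMap.range E.vecMulLinear) :=
    Module.Projective.of_split (LinearMap.range E.vecMulLinear).subtype
      E.vecMulLinear.rangeRestrict (by ext x : 2; exact hv x)
  FGProjective.ofModule R (LinearMap.range E.vecMulLinear)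

section Reduction

variable {R S : Type w} [Ring R] [Ring S] {φ : R →+* S}

/-- `φ` lifts idempotent square matrices. -/
def LiftsMatrixIdempotents (φ : R →+* S) : Prop :=
  ∀ (n : ℕ) (e : Matrix (Fin n) (Fin n) S), e * e = e →
    ∃ E : Matrix (Fin n) (Fin n) R, E * E = E ∧ E.map φ = e

/-- The submodule `I P` for the kernel `I` of `φ`. -/
abbrev kerSMul (φ : R →+* S) (P : Type w) [AddCommGroup P] [Module R P] : Submodule R P :=
  Submodule.span R {y | ∃ a ∈ RingHom.ker φ, ∃ z : P, y = a • z}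

theorem map_mem_kerSMul {P P' : Type w} [AddCommGroup P] [Module R P] [AddCommGroup P']
    [Module R P'] (f : P →ₗ[R] P') {x : P} (hx : x ∈ kerSMul φ P) : f x ∈ kerSMul φ P' := by
  have : kerSMul φ P ≤ (kerSMul φ P').comap f := by
    refine Submodule.span_le.2 ?_
    rintro _ ⟨a, ha, z, rfl⟩
    exact Submodule.subset_span ⟨a, ha, f z, by simp⟩
  exact this hx

theorem kerSMul_le_ker {P Q : Type w} [AddCommGroup P] [Module R P] [AddCommGroup Q] [Module S Q]
    (π : P →ₛₗ[φ] Q) {x : P} (hx : x ∈ kerSMul φ P) : π x = 0 := by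
  have : kerSMul φ P ≤ LinearMap.ker π := by
    refine Submodule.span_le.2 ?_
    rintro _ ⟨a, ha, z, rfl⟩
    simp [RingHom.mem_ker.1 ha]
  exact this hx

theorem mem_kerSMul_of_map_eq_zero {n : ℕ} {P : Type w} [AddCommGroup P] [Module R P]
    (s : (Fin n → R) →ₗ[R] P) (v : Fin n → R) (hv : ∀ j, φ (v j) = 0) : s v ∈ kerSMul φ P := by
  rw [pi_eq_sum_univ' v, map_sum]
  refine Submodule.sum_mem _ fun j _ => ?_
  rw [map_smul]
  exact Submodule.subset_span ⟨v j, hv j, _, rfl⟩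

/-- The coordinatewise application of a ring homomorphism. -/
def piSemilinear (φ : R →+* S) (n : ℕ) : (Fin n → R) →ₛₗ[φ] (Fin n → S) where
  toFun v j := φ (v j)
  map_add' _ _ := by ext; simp
  map_smul' _ _ := by ext; simp

theorem piSemilinear_vecMul {n : ℕ} (v : Fin n → R) (E : Matrix (Fin n) (Fin n) R) :
    piSemilinear φ n (Matrix.vecMul v E) = Matrix.vecMul (piSemilinear φ n v) (E.map φ) := by
  ext j
  simp [piSemilinear, Matrix.vecMul, dotProduct]

theorem piSemilinear_surjective (hφ : Function.Surjective φ) (n : ℕ) :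
    Function.Surjective (piSemilinear φ n) := fun v => by
  choose g hg using hφ
  exact ⟨fun j => g (v j), by ext j; simp [piSemilinear, hg]⟩

/-- `P` is the row space of `E`, and `φ` maps it coordinatewise onto the row space of `E.map φ`. If
`x` goes to zero, its coordinates lie in the kernel `I`, and `x = s (i x)` puts it in `I P`. -/
theorem exists_isReduction (hφ : Function.Surjective φ) (P : FGProjective R) :
    ∃ Q : FGProjective S, IsReduction φ P Q := by
  obtain ⟨n, i, s, E, hsi, hE, hiE⟩ := P.exists_coordinates
  have he : E.map φ * E.map φ = E.map φ := by rw [← Matrix.map_mul, hE]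
  refine ⟨idempotentRowSpace (E.map φ) he, ?_⟩
  let π₀ : P.carrier →ₛₗ[φ] (Fin n → S) := (piSemilinear φ n).comp i
  have hπ₀ : ∀ x, π₀ x ∈ LinearMap.range (E.map φ).vecMulLinear := fun x =>
    ⟨π₀ x, by
      change Matrix.vecMul (piSemilinear φ n (i x)) _ = piSemilinear φ n (i x)
      rw [← piSemilinear_vecMul, ← hiE, hsi]⟩
  let π : P.carrier →ₛₗ[φ] LinearMap.range (E.map φ).vecMulLinear := π₀.codRestrict _ hπ₀
  refine ⟨π, ?_, fun x => ⟨fun hx => ?_, fun hx => kerSMul_le_ker (Q := LinearMap.range (E.map φ).vecMulLinear) π hx⟩⟩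
  · rintro ⟨_, w, rfl⟩
    obtain ⟨v, rfl⟩ := piSemilinear_surjective hφ n w
    refine ⟨s v, Subtype.ext ?_⟩
    change piSemilinear φ n (i (s v)) = _
    rw [hiE, piSemilinear_vecMul]
    rfl
  · have hx' : π₀ x = 0 := congrArg Subtype.val hx
    rw [← hsi x]
    exact mem_kerSMul_of_map_eq_zero s (i x) fun j => congrFun hx' j

theorem exists_isReduction_lift (hφ : Function.Surjective φ) (hl : LiftsMatrixIdempotents φ)
    (Q : FGProjective S) : ∃ P : FGProjective R, IsReduction φ P Q := by
  obtain ⟨n, i, s, e, hsi, he, hie⟩ := Q.exists_coordinates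
  obtain ⟨E, hE, hEe⟩ := hl n e he
  refine ⟨idempotentRowSpace E hE, ?_⟩
  have hv : ∀ x : LinearMap.range E.vecMulLinear, Matrix.vecMul (x : Fin n → R) E = x := by
    rintro ⟨_, v, rfl⟩
    simp [Matrix.vecMul_vecMul, hE]
  let π : LinearMap.range E.vecMulLinear →ₛₗ[φ] Q.carrier :=
    (s.comp (piSemilinear φ n)).comp (LinearMap.range E.vecMulLinear).subtype
  refine ⟨π, fun y => ?_, fun x => ⟨fun hx => ?_, fun hx => kerSMul_le_ker (P := LinearMap.range E.vecMulLinear) π hx⟩⟩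
  · obtain ⟨v, hvy⟩ := piSemilinear_surjective hφ n (i y)
    refine ⟨⟨Matrix.vecMul v E, v, rfl⟩, ?_⟩
    change s (piSemilinear φ n (Matrix.vecMul v E)) = y
    rw [piSemilinear_vecMul, hvy, hEe, ← hie, hsi, hsi]
  · change s (piSemilinear φ n x.1) = 0 at hx
    have h0 : piSemilinear φ n x.1 = 0 := by
      rw [← hv x, piSemilinear_vecMul, hEe, ← hie, hx, map_zero]
    have h1 : E.vecMulLinear.rangeRestrict x.1 = x := Subtype.ext (hv x)
    have h2 := mem_kerSMul_of_map_eq_zero (φ := φ) E.vecMulLinear.rangeRestrict x.1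
      fun j => congrFun h0 j
    rw [h1] at h2
    exact h2

/-- An isomorphism carries `I P` onto `I P'`, so it descends to the quotients. The map is written
with a set-theoretic section `g` of `π`; `hkk` makes it independent of that choice. -/
theorem IsReduction.equiv (hφ : Function.Surjective φ) {P P' : FGProjective R}
    {Q Q' : FGProjective S} (e : P.carrier ≃ₗ[R] P'.carrier) (h : IsReduction φ P Q)
    (h' : IsReduction φ P' Q') : Nonempty (Q.carrier ≃ₗ[S] Q'.carrier) := by
  obtain ⟨π, hπ, hk⟩ := h
  obtain ⟨π', hπ', hk'⟩ := h'
  choose g hg using hπ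
  have hkk : ∀ x y, π x = π y ↔ π' (e x) = π' (e y) := by
    intro x y
    rw [← sub_eq_zero, ← map_sub, hk, ← sub_eq_zero (a := π' (e x)), ← map_sub, hk', ← map_sub]
    exact ⟨fun h => map_mem_kerSMul e.toLinearMap h, fun h => by
      have : e.symm (e (x - y)) ∈ kerSMul φ P.carrier := map_mem_kerSMul e.symm.toLinearMap h
      rwa [e.symm_apply_apply] at this⟩
  have key : ∀ x, π' (e (g (π x))) = π' (e x) := fun x => (hkk _ _).1 (hg _)
  let f : Q.carrier →ₗ[S] Q'.carrier :=
    { toFun := fun y => π' (e (g y))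
      map_add' := fun a b => by
        rw [← map_add, ← map_add]
        exact (hkk _ _).1 (by rw [map_add, hg, hg, hg])
      map_smul' := fun c a => by
        obtain ⟨r, rfl⟩ := hφ c
        rw [RingHom.id_apply, ← LinearMap.map_smulₛₗ, ← map_smul]
        exact (hkk _ _).1 (by rw [LinearMap.map_smulₛₗ, hg, hg]) }
  refine ⟨LinearEquiv.ofBijective f ⟨fun a b hab => ?_, fun y => ?_⟩⟩
  · have := (hkk _ _).2 hab
    rwa [hg, hg] at this
  · obtain ⟨x, rfl⟩ := hπ' y
    exact ⟨π (e.symm x), (key _).trans (by rw [e.apply_symm_apply])⟩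

/-- Nakayama's lemma: the cokernel of `f` is finitely generated and equal to its product with the
Jacobson radical, hence zero. -/
theorem surjective_of_map_kerSMul (hk : RingHom.ker φ ≤ Ring.jacobson R) {P P' : Type w}
    [AddCommGroup P] [Module R P] [AddCommGroup P'] [Module R P'] [Module.Finite R P']
    (f : P →ₗ[R] P') (hf : ∀ y, ∃ x, y - f x ∈ kerSMul φ P') : Function.Surjective f := by
  have hle : kerSMul φ P' ≤ Ring.jacobson R • (⊤ : Submodule R P') := by
    refine Submodule.span_le.2 ?_
    rintro _ ⟨a, ha, z, rfl⟩
    exact Submodule.smul_mem_smul (hk ha) trivial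
  rw [← LinearMap.range_eq_top]
  by_contra hne
  have : Nontrivial (P' ⧸ LinearMap.range f) := Submodule.Quotient.nontrivial_iff.2 hne
  have h1 := Submodule.jacobson_smul_lt_top (R := R) (⊤ : Submodule R (P' ⧸ LinearMap.range f))
  refine h1.ne ?_
  rw [eq_top_iff]
  rintro y -
  obtain ⟨y, rfl⟩ := Submodule.mkQ_surjective _ y
  obtain ⟨x, hx⟩ := hf y
  have h2 := Submodule.mem_map_of_mem (f := (LinearMap.range f).mkQ) (hle hx)
  rw [Submodule.map_smul'', Submodule.map_top, Submodule.range_mkQ] at h2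
  have h3 : (LinearMap.range f).mkQ (f x) = 0 := by simp
  rwa [map_sub, h3, sub_zero] at h2

/-- Uniqueness of projective covers. Projectivity lifts `e ∘ π` to some `f`, which is surjective by
Nakayama and therefore has a section; the section inverts `e` modulo `I`, so it is surjective too,
and `f` is injective. -/
theorem IsReduction.equiv_lift (hk : RingHom.ker φ ≤ Ring.jacobson R) {P P' : FGProjective R}
    {Q Q' : FGProjective S} (e : Q.carrier ≃ₗ[S] Q'.carrier) (h : IsReduction φ P Q)
    (h' : IsReduction φ P' Q') : Nonempty (P.carrier ≃ₗ[R] P'.carrier) := by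
  obtain ⟨π, hπ, hkπ⟩ := h
  obtain ⟨π', hπ', hkπ'⟩ := h'
  -- Viewing `Q'` as an `R`-module through `φ` turns the semilinear maps into linear ones, to which
  -- projective lifting applies.
  let : Module R Q'.carrier := Module.compHom _ φ
  let σ : P.carrier →ₗ[R] Q'.carrier :=
    { toFun := fun x => e (π x), map_add' := by simp, map_smul' := fun r x => by
        rw [LinearMap.map_smulₛₗ, map_smul]; rfl }
  let σ' : P'.carrier →ₗ[R] Q'.carrier :=
    { toFun := π', map_add' := by simp, map_smul' := fun r x => LinearMap.map_smulₛₗ _ _ _ }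
  obtain ⟨f, hf⟩ := Module.projective_lifting_property σ' σ hπ'
  have hf' : ∀ x, π' (f x) = e (π x) := fun x => LinearMap.congr_fun hf x
  have fsurj : Function.Surjective f := by
    refine surjective_of_map_kerSMul hk f fun y => ?_
    obtain ⟨x, hx⟩ := hπ (e.symm (π' y))
    exact ⟨x, (hkπ' _).1 (by rw [map_sub, hf', hx]; simp)⟩
  obtain ⟨s, hs⟩ := Module.projective_lifting_property f LinearMap.id fsurj
  have hs' : ∀ x, f (s x) = x := fun x => LinearMap.congr_fun hs x
  have ssurj : Function.Surjective s := by
    refine surjective_of_map_kerSMul hk s fun y => ⟨f y, (hkπ _).1 ?_⟩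
    rw [map_sub, sub_eq_zero]
    apply e.injective
    rw [← hf', ← hf', hs']
  refine ⟨LinearEquiv.ofBijective f ⟨fun a b hab => ?_, fsurj⟩⟩
  obtain ⟨a, rfl⟩ := ssurj a
  obtain ⟨b, rfl⟩ := ssurj b
  rw [hs', hs'] at hab
  rw [hab]

theorem IsReduction.prod {P P' : FGProjective R} {Q Q' : FGProjective S} (h : IsReduction φ P Q)
    (h' : IsReduction φ P' Q') : IsReduction φ (P.prod P') (Q.prod Q') := by
  obtain ⟨π, hπ, hk⟩ := h
  obtain ⟨π', hπ', hk'⟩ := h'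
  let ρ : P.carrier × P'.carrier →ₛₗ[φ] Q.carrier × Q'.carrier :=
    { toFun := fun x => (π x.1, π' x.2), map_add' := by simp, map_smul' := by simp }
  refine ⟨ρ, fun y => ?_, fun x => ⟨fun hx => ?_, fun hx => kerSMul_le_ker (P := P.carrier × P'.carrier) ρ hx⟩⟩
  · obtain ⟨a, ha⟩ := hπ y.1
    obtain ⟨b, hb⟩ := hπ' y.2
    exact ⟨(a, b), Prod.ext ha hb⟩
  · have h1 := map_mem_kerSMul (LinearMap.inl R P.carrier P'.carrier)
      ((hk x.1).1 (congrArg Prod.fst hx))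
    have h2 := map_mem_kerSMul (LinearMap.inr R P.carrier P'.carrier)
      ((hk' x.2).1 (congrArg Prod.snd hx))
    have h3 := Submodule.add_mem _ h1 h2
    have h4 : LinearMap.inl R P.carrier P'.carrier x.1 + LinearMap.inr R P.carrier P'.carrier x.2
        = x := by ext <;> simp
    rw [h4] at h3
    exact h3

end Reduction

/-! ### Relations in the Grothendieck group -/

namespace K0

variable {R : Type w} [Ring R]

theorem mk_eq_add {P₁ P P₂ : FGProjective R} (f : P₁.carrier →ₗ[R] P.carrier)
    (g : P.carrier →ₗ[R] P₂.carrier) (hf : Function.Injective f) (hfg : Function.Exact f g)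
    (hg : Function.Surjective g) : K0.mk P = K0.mk P₁ + K0.mk P₂ := by
  refine (QuotientAddGroup.eq_iff_sub_mem
    (N := AddSubgroup.closure (K0Relations R))).2 (AddSubgroup.subset_closure ?_)
  exact ⟨P₁, P, P₂, f, g, hf, hfg, hg, (sub_sub _ _ _).symm⟩

theorem mk_eq_zero (P : FGProjective R) [Subsingleton P.carrier] : K0.mk P = 0 := by
  -- For `P = 0` the sequence `0 → P → P → P → 0` is exact and gives `[P] = [P] + [P]`.
  have := mk_eq_add (P₁ := P) (P := P) (P₂ := P) LinearMap.id LinearMap.id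
    (fun _ _ h => h) (fun x => ⟨fun _ => ⟨x, rfl⟩, fun _ => Subsingleton.elim _ _⟩) (fun x => ⟨x, rfl⟩)
  simpa using this

theorem mk_eq_of_equiv {P Q : FGProjective R} (e : P.carrier ≃ₗ[R] Q.carrier) :
    K0.mk P = K0.mk Q := by
  let Z : FGProjective R := FGProjective.ofModule R PUnit
  have : Subsingleton Z.carrier := inferInstanceAs (Subsingleton PUnit)
  rw [mk_eq_add (P₁ := Z) (P := P) (P₂ := Q) 0 e.toLinearMap (fun _ _ _ => Subsingleton.elim _ _)
    (fun x => ⟨fun h => ⟨0, by simpa using (e.map_eq_zero_iff.1 h).symm⟩, by rintro ⟨y, rfl⟩; simp⟩) e.surjective,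
    mk_eq_zero, zero_add]

theorem mk_prod (P Q : FGProjective R) : K0.mk (P.prod Q) = K0.mk P + K0.mk Q :=
  mk_eq_add (P := P.prod Q) (LinearMap.inl R P.carrier Q.carrier)
    (LinearMap.snd R P.carrier Q.carrier)
    LinearMap.inl_injective Function.Exact.inl_snd LinearMap.snd_surjective

/-- The sequence splits since `P₂` is projective; this is why `lift` asks for additivity on direct
sums only. -/
theorem exists_prod_equiv {P₁ P P₂ : FGProjective R} (f : P₁.carrier →ₗ[R] P.carrier)
    (g : P.carrier →ₗ[R] P₂.carrier) (hf : Function.Injective f) (hfg : Function.Exact f g)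
    (hg : Function.Surjective g) : Nonempty (P.carrier ≃ₗ[R] (P₁.prod P₂).carrier) := by
  obtain ⟨s, hs⟩ := Module.projective_lifting_property g LinearMap.id hg
  exact ⟨(hfg.splitSurjectiveEquiv hf ⟨s, hs⟩).1⟩

/-- The homomorphism out of the Grothendieck group defined by a function that is invariant under
isomorphism and additive on direct sums. -/
noncomputable def lift {B : Type*} [AddCommGroup B] (F : FGProjective R → B)
    (hF : ∀ P Q : FGProjective R, Nonempty (P.carrier ≃ₗ[R] Q.carrier) → F P = F Q)
    (hadd : ∀ P Q : FGProjective R, F (P.prod Q) = F P + F Q) : K0 R →+ B :=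
  QuotientAddGroup.lift _ (FreeAbelianGroup.lift F) <| by
    rw [AddSubgroup.closure_le]
    rintro _ ⟨P₁, P, P₂, f, g, hf, hfg, hg, rfl⟩
    have := hF _ _ (exists_prod_equiv f g hf hfg hg)
    simp [this, hadd]

@[simp]
theorem lift_mk {B : Type*} [AddCommGroup B] (F : FGProjective R → B)
    (hF : ∀ P Q : FGProjective R, Nonempty (P.carrier ≃ₗ[R] Q.carrier) → F P = F Q)
    (hadd : ∀ P Q : FGProjective R, F (P.prod Q) = F P + F Q) (P : FGProjective R) :
    lift F hF hadd (K0.mk P) = F P := by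
  change FreeAbelianGroup.lift F (FreeAbelianGroup.of P) = F P
  simp

theorem induction {p : K0 R → Prop} (hmk : ∀ P, p (K0.mk P)) (hadd : ∀ x y, p x → p y → p (x + y))
    (hneg : ∀ x, p x → p (-x)) (x : K0 R) : p x := by
  obtain ⟨x, rfl⟩ := QuotientAddGroup.mk_surjective x
  have h0 : p 0 := by
    let Z : FGProjective R := FGProjective.ofModule R PUnit
    have : Subsingleton Z.carrier := inferInstanceAs (Subsingleton PUnit)
    exact mk_eq_zero Z ▸ hmk Z
  induction x using FreeAbelianGroup.induction_on with
  | zero => exact h0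
  | of P => exact hmk P
  | neg P h => exact hneg _ h
  | add x y hx hy => exact hadd _ _ hx hy

theorem hom_ext {B : Type*} [AddCommGroup B] {f g : K0 R →+ B}
    (h : ∀ P, f (K0.mk P) = g (K0.mk P)) : f = g := by
  refine DFunLike.ext _ _ fun x => ?_
  induction x using K0.induction with
  | hmk P => exact h P
  | hadd x y hx hy => rw [map_add, map_add, hx, hy]
  | hneg x hx => rw [map_neg, map_neg, hx]

/-- Reduction along a surjection that lifts idempotent matrices and has its kernel in the Jacobson
radical is an isomorphism of Grothendieck groups. -/
theorem exists_equiv_of_reduction {R S : Type w} [Ring R] [Ring S] {φ : R →+* S}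
    (hφ : Function.Surjective φ) (hk : RingHom.ker φ ≤ Ring.jacobson R)
    (hl : LiftsMatrixIdempotents φ) :
    ∃ e : K0 R ≃+ K0 S, ∀ P Q, IsReduction φ P Q → e (K0.mk P) = K0.mk Q := by
  -- Reductions and lifts are unique up to isomorphism (`IsReduction.equiv`,
  -- `IsReduction.equiv_lift`), so arbitrary choices induce well-defined, mutually inverse maps on
  -- classes.
  choose red hred using exists_isReduction (φ := φ) hφ
  choose lft hlft using exists_isReduction_lift (φ := φ) hφ hl
  let f : K0 R →+ K0 S := lift (fun P => K0.mk (red P))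
    (fun P P' ⟨e⟩ => ((hred P).equiv hφ e (hred P')).elim fun e => mk_eq_of_equiv e)
    (fun P P' => by
      rw [← mk_prod]
      obtain ⟨e⟩ := (hred (P.prod P')).equiv hφ (LinearEquiv.refl _ _) ((hred P).prod (hred P'))
      exact mk_eq_of_equiv e)
  let g : K0 S →+ K0 R := lift (fun Q => K0.mk (lft Q))
    (fun Q Q' ⟨e⟩ => ((hlft Q).equiv_lift hk e (hlft Q')).elim fun e => mk_eq_of_equiv e)
    (fun Q Q' => by
      rw [← mk_prod]
      obtain ⟨e⟩ := (hlft (Q.prod Q')).equiv_lift hk (LinearEquiv.refl _ _)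
        ((hlft Q).prod (hlft Q'))
      exact mk_eq_of_equiv e)
  have hf : ∀ P Q, IsReduction φ P Q → f (K0.mk P) = K0.mk Q := fun P Q h => by
    obtain ⟨e⟩ := (hred P).equiv hφ (LinearEquiv.refl _ _) h
    simpa [f] using mk_eq_of_equiv e
  have hg : ∀ P Q, IsReduction φ P Q → g (K0.mk Q) = K0.mk P := fun P Q h => by
    obtain ⟨e⟩ := (hlft Q).equiv_lift hk (LinearEquiv.refl _ _) h
    simpa [g] using mk_eq_of_equiv e
  refine ⟨AddMonoidHom.toAddEquiv f g (hom_ext fun P => ?_) (hom_ext fun Q => ?_), hf⟩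
  · simp [hf _ _ (hred P), hg _ _ (hred P)]
  · simp [hg _ _ (hlft Q), hf _ _ (hlft Q)]

end K0

/-! ### The Grothendieck group of a product of matrix rings over division rings -/

section PiMatrix

variable {ι : Type} (D : ι → Type w) [∀ i, DivisionRing (D i)]
  (d : ι → ℕ)

/-- A product of matrix rings. -/
abbrev PiMatrix : Type w := ∀ i, Matrix (Fin (d i)) (Fin (d i)) (D i)

/-- The module of column vectors of the `i`-th factor of a product of matrix rings. -/
def PiMatrix.Column (i : ι) : Type w := Fin (d i) → D i

namespace PiMatrix

instance (i : ι) : AddCommGroup (Column D d i) :=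
  inferInstanceAs (AddCommGroup (Fin (d i) → D i))

instance (i : ι) : Module (PiMatrix D d) (Column D d i) where
  smul b v := Matrix.mulVec (b i) v
  one_smul := Matrix.one_mulVec
  mul_smul a b v := (Matrix.mulVec_mulVec v (a i) (b i)).symm
  smul_zero a := Matrix.mulVec_zero (a i)
  smul_add a := Matrix.mulVec_add (a i)
  add_smul a b := Matrix.add_mulVec (a i) (b i)
  zero_smul := Matrix.zero_mulVec

theorem Column.smul_def (i : ι) (b : PiMatrix D d) (v : Column D d i) :
    b • v = Matrix.mulVec (b i) v := rfl

variable [DecidableEq ι]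

theorem exists_smul_eq (i : ι) {v : Column D d i} (hv : v ≠ 0) (w : Column D d i) :
    ∃ b : PiMatrix D d, b • v = w := by
  obtain ⟨j, hj⟩ : ∃ j, v j ≠ 0 := by
    by_contra! h
    exact hv (funext h)
  -- Only the `j`-th column is nonzero: it is `w` scaled by the inverse of the nonzero coordinate `v
  -- j`.
  refine ⟨Pi.single i (Matrix.of fun a c => if c = j then w a * (v j)⁻¹ else 0), ?_⟩
  rw [Column.smul_def, Pi.single_eq_same]
  refine funext fun a => ?_
  simp [Matrix.mulVec, dotProduct, hj]

instance (i : ι) [NeZero (d i)] : IsSimpleModule (PiMatrix D d) (Column D d i) := by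
  have : Nontrivial (Column D d i) := inferInstanceAs (Nontrivial (Fin (d i) → D i))
  refine isSimpleModule_iff_toSpanSingleton_surjective.2 ⟨this, fun v hv w => ?_⟩
  exact exists_smul_eq D d i hv w

/-- Multiplication by the central idempotent of the `i`-th factor. -/
def proj (i : ι) (P : Type w) [AddCommGroup P] [Module (PiMatrix D d) P] :
    P →ₗ[PiMatrix D d] P where
  toFun x := (Pi.single i 1 : PiMatrix D d) • x
  map_add' := smul_add _
  map_smul' b x := by
    simp only [smul_smul, RingHom.id_apply]
    congr 1
    ext j : 1
    by_cases h : j = i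
    · subst h; simp
    · simp [h]

theorem proj_apply (i : ι) (P : Type w) [AddCommGroup P] [Module (PiMatrix D d) P] (x : P) :
    proj D d i P x = (Pi.single i 1 : PiMatrix D d) • x := rfl

/-- The composition length of the `i`-th component of a module. -/
noncomputable def multiplicity (i : ι) (P : FGProjective (PiMatrix D d)) : ℤ :=
  ((Module.length (PiMatrix D d) (LinearMap.range (proj D d i P.carrier))).toNat : ℤ)

variable {D d}

theorem multiplicity_eq_of_equiv (i : ι) {P Q : FGProjective (PiMatrix D d)}
    (e : P.carrier ≃ₗ[PiMatrix D d] Q.carrier) : multiplicity D d i P = multiplicity D d i Q := by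
  have h : (LinearMap.range (proj D d i P.carrier)).map e.toLinearMap =
      LinearMap.range (proj D d i Q.carrier) := by
    ext y
    constructor
    · rintro ⟨_, ⟨x, rfl⟩, rfl⟩
      exact ⟨e x, by simp [proj_apply]⟩
    · rintro ⟨x, rfl⟩
      exact ⟨_, ⟨e.symm x, rfl⟩, by simp [proj_apply]⟩
  rw [multiplicity, multiplicity, (e.submoduleMap _).length_eq, h]

variable [Fintype ι]

theorem multiplicity_prod (i : ι) (P Q : FGProjective (PiMatrix D d)) :
    multiplicity D d i (P.prod Q) = multiplicity D d i P + multiplicity D d i Q := by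
  have h : LinearMap.range (proj D d i (P.carrier × Q.carrier)) =
      (LinearMap.range (proj D d i P.carrier)).prod (LinearMap.range (proj D d i Q.carrier)) := by
    ext ⟨x, y⟩
    constructor
    · rintro ⟨⟨a, b⟩, h⟩
      exact ⟨⟨a, congrArg Prod.fst h⟩, ⟨b, congrArg Prod.snd h⟩⟩
    · rintro ⟨⟨a, ha⟩, ⟨b, hb⟩⟩
      exact ⟨(a, b), Prod.ext ha hb⟩
  change ((Module.length (PiMatrix D d)
    (LinearMap.range (proj D d i (P.carrier × Q.carrier)))).toNat : ℤ) = _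
  let e : ((LinearMap.range (proj D d i P.carrier)).prod
      (LinearMap.range (proj D d i Q.carrier)) : Submodule _ _) ≃ₗ[PiMatrix D d]
      LinearMap.range (proj D d i P.carrier) × LinearMap.range (proj D d i Q.carrier) :=
    { toFun := fun x => (⟨x.1.1, x.2.1⟩, ⟨x.1.2, x.2.2⟩)
      invFun := fun x => ⟨(x.1, x.2), x.1.2, x.2.2⟩
      map_add' := fun _ _ => rfl
      map_smul' := fun _ _ => rfl
      left_inv := fun _ => rfl
      right_inv := fun _ => rfl }
  -- Lengths are finite, as the modules are finitely generated over a semisimple ring; without this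
  -- `toNat` would not be additive.
  rw [h, e.length_eq, Module.length_prod, ENat.toNat_add Module.length_ne_top
    Module.length_ne_top]
  rfl

variable (D d) in
/-- The class of the column module. -/
def column [∀ i, NeZero (d i)] (i : ι) : FGProjective (PiMatrix D d) :=
  have : Module.Projective (PiMatrix D d) (Column D d i) :=
    Module.projective_of_isSemisimpleRing _ _
  FGProjective.ofModule _ (Column D d i)

theorem multiplicity_column [∀ i, NeZero (d i)] (i j : ι) :
    multiplicity D d i (column D d j) = if i = j then 1 else 0 := by
  change ((Module.length (PiMatrix D d)
    (LinearMap.range (proj D d i (Column D d j)))).toNat : ℤ) = _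
  split_ifs with h
  · subst h
    have : proj D d i (Column D d i) = LinearMap.id := by
      ext x : 1
      rw [proj_apply, Column.smul_def, Pi.single_eq_same]
      exact Matrix.one_mulVec (x : Fin (d i) → D i)
    rw [this, LinearMap.range_id, Submodule.topEquiv.length_eq, Module.length_eq_one]
    rfl
  · have : proj D d i (Column D d j) = 0 := by
      ext x : 1
      rw [proj_apply, Column.smul_def, Pi.single_eq_of_ne' h]
      exact Matrix.zero_mulVec (x : Fin (d j) → D j)
    rw [this, LinearMap.range_zero, Module.length_bot]
    rfl

/-- Some diagonal matrix unit does not kill `v`, because they sum to `1`. Sending `x` to the matrix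
with `j`-th column `x`, applied to `v`, is then a nonzero map between simple modules, and Schur's
lemma applies. -/
theorem exists_equiv_column [∀ i, NeZero (d i)] (P : Type w) [AddCommGroup P]
    [Module (PiMatrix D d) P] [IsSimpleModule (PiMatrix D d) P] :
    ∃ i, Nonempty (Column D d i ≃ₗ[PiMatrix D d] P) := by
  have := IsSimpleModule.nontrivial (PiMatrix D d) P
  obtain ⟨v, hv⟩ := exists_ne (0 : P)
  have h1 : ∑ i, ∑ j, (Pi.single i (Matrix.single j j 1) : PiMatrix D d) = 1 := by
    ext i : 1
    simp only [Finset.sum_apply]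
    rw [Finset.sum_eq_single i]
    · simp [Matrix.sum_single_one]
    · intro b _ hb
      simp [Pi.single_eq_of_ne' hb]
    · simp
  obtain ⟨i, j, hij⟩ : ∃ i j, (Pi.single i (Matrix.single j j 1) : PiMatrix D d) • v ≠ 0 := by
    by_contra! h
    apply hv
    rw [← one_smul (PiMatrix D d) v, ← h1]
    simp [Finset.sum_smul, h]
  let f : Column D d i →ₗ[PiMatrix D d] P :=
    { toFun := fun x => (Pi.single i (Matrix.of fun a c => if c = j then x a else 0) :
        PiMatrix D d) • v
      map_add' := fun x y => by
        rw [← add_smul, ← Pi.single_add]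
        congr 2
        ext a c
        simp only [Matrix.of_apply, Matrix.add_apply]
        split_ifs
        · rfl
        · simp
      map_smul' := fun b x => by
        rw [RingHom.id_apply, smul_smul]
        congr 1
        ext k : 1
        by_cases hk : k = i
        · subst hk
          ext a c
          simp only [Pi.single_eq_same, Pi.mul_apply, Matrix.mul_apply, Matrix.of_apply,
            Column.smul_def, Matrix.mulVec, dotProduct]
          split_ifs <;> simp
        · simp [hk] }
  refine ⟨i, ⟨LinearEquiv.ofBijective f (LinearMap.bijective_of_ne_zero fun hf => hij ?_)⟩⟩
  have h2 : f (Pi.single j 1 : Fin (d i) → D i) = 0 := LinearMap.congr_fun hf _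
  rw [← h2]
  change _ = (Pi.single i _ : PiMatrix D d) • v
  congr 2
  ext a c
  by_cases hc : c = j
  · simp [Matrix.single_apply, Pi.single_apply, hc, eq_comm]
  · simp [hc, Ne.symm hc]

/-- Induction along a composition series. All modules over a semisimple ring are projective, so
submodules and simple quotients have classes of their own. -/
theorem K0_mk_mem_closure [∀ i, NeZero (d i)] (P : FGProjective (PiMatrix D d)) :
    K0.mk P ∈ AddSubgroup.closure (Set.range fun i => K0.mk (column D d i)) := by
  have key : ∀ (M : Type w) [AddCommGroup M] [Module (PiMatrix D d) M],
      IsFiniteLength (PiMatrix D d) M → ∀ P : FGProjective (PiMatrix D d),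
      Nonempty (P.carrier ≃ₗ[PiMatrix D d] M) →
      K0.mk P ∈ AddSubgroup.closure (Set.range fun i => K0.mk (column D d i)) := by
    intro M _ _ hM
    induction hM with
    | of_subsingleton =>
      rintro P ⟨e⟩
      have := e.toEquiv.subsingleton
      rw [K0.mk_eq_zero]
      exact zero_mem _
    | @of_simple_quotient M _ _ N _ hN ih =>
      rintro P ⟨e⟩
      have : Module.Finite (PiMatrix D d) M := Module.Finite.equiv e
      have h1 : Module.Projective (PiMatrix D d) N := Module.projective_of_isSemisimpleRing _ _
      have h2 : Module.Projective (PiMatrix D d) (M ⧸ N) :=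
        Module.projective_of_isSemisimpleRing _ _
      have h3 : Module.Projective (PiMatrix D d) M := Module.projective_of_isSemisimpleRing _ _
      rw [K0.mk_eq_of_equiv (Q := FGProjective.ofModule _ M) e,
        K0.mk_eq_add (P := FGProjective.ofModule _ M) (P₁ := FGProjective.ofModule _ N)
          (P₂ := FGProjective.ofModule _ (M ⧸ N)) N.subtype N.mkQ N.subtype_injective
          (LinearMap.exact_subtype_mkQ N) N.mkQ_surjective]
      refine add_mem (ih _ ⟨LinearEquiv.refl _ _⟩) (AddSubgroup.subset_closure ?_)
      obtain ⟨i, ⟨f⟩⟩ := exists_equiv_column (D := D) (d := d) (M ⧸ N)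
      exact ⟨i, K0.mk_eq_of_equiv f⟩
  exact key P.carrier (Module.length_ne_top_iff.1 Module.length_ne_top) P ⟨LinearEquiv.refl _ _⟩

-- The column classes generate, and the multiplicities form a dual family, which makes them
-- independent.
variable (D d) in
theorem nonempty_K0_equiv [∀ i, NeZero (d i)] :
    Nonempty (K0 (PiMatrix D d) ≃+ (ι → ℤ)) := by
  let F : K0 (PiMatrix D d) →+ (ι → ℤ) := K0.lift (fun P i => multiplicity D d i P)
    (fun P Q ⟨e⟩ => funext fun i => multiplicity_eq_of_equiv i e)
    (fun P Q => funext fun i => multiplicity_prod i P Q)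
  let g : (ι → ℤ) →+ K0 (PiMatrix D d) :=
    { toFun := fun v => ∑ i, v i • K0.mk (column D d i)
      map_zero' := by simp
      map_add' := by simp [add_smul, Finset.sum_add_distrib] }
  have hFg : ∀ v, F (g v) = v := by
    intro v
    simp only [g, F, AddMonoidHom.coe_mk, ZeroHom.coe_mk, map_sum, map_zsmul, K0.lift_mk,
      multiplicity_column]
    ext i
    simp [Finset.sum_apply]
  have hg : Function.Surjective g := by
    rw [← AddMonoidHom.range_eq_top, eq_top_iff]
    rintro x -
    have hle : AddSubgroup.closure (Set.range fun i => K0.mk (column D d i)) ≤ g.range := by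
      rw [AddSubgroup.closure_le]
      rintro _ ⟨i, rfl⟩
      refine ⟨Pi.single i 1, ?_⟩
      simp only [g, AddMonoidHom.coe_mk, ZeroHom.coe_mk]
      rw [Finset.sum_eq_single i]
      · simp
      · intro b _ hb; simp [hb]
      · simp
    induction x using K0.induction with
    | hmk P => exact hle (K0_mk_mem_closure P)
    | hadd x y hx hy => exact add_mem hx hy
    | hneg x hx => exact neg_mem hx
  exact ⟨(AddEquiv.ofBijective g
    ⟨Function.LeftInverse.injective hFg, hg⟩).symm⟩

end PiMatrix

end PiMatrix

/-! ### Trace functions -/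

/-- An additive function is a trace function if it does not distinguish `x * y` from `y * x`. -/
def IsTraceFunction {R Q : Type*} [Ring R] [AddCommGroup Q] (t : R →+ Q) : Prop :=
  ∀ x y, t (x * y) = t (y * x)

/-- Nontrivial orbits of `σ` have `p` elements with the same value of `W`, so they contribute zero.
The proof counts fixed points modulo `p` on each fibre of `W`. -/
theorem sum_eq_sum_fixedPoints {X Q : Type*} [Fintype X] [DecidableEq X] [AddCommGroup Q] {p : ℕ}
    [Fact p.Prime] (hQ : ∀ z : Q, p • z = 0) (σ : Equiv.Perm X) (hσ : σ ^ p = 1) (W : X → Q)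
    (hW : ∀ x, W (σ x) = W x) : ∑ x, W x = ∑ x with σ x = x, W x := by
  classical
  rw [Finset.sum_comp (fun z : Q => z) W, Finset.sum_comp (fun z : Q => z) W]
  refine Eq.trans ?_ (Finset.sum_subset (Finset.image_subset_image (Finset.subset_univ _))
    fun w _ hw => ?_).symm
  · refine Finset.sum_congr rfl fun w _ => ?_
    let τ : Equiv.Perm {x // W x = w} := σ.subtypePerm fun x => by rw [hW]
    let τ' : Function.End {x // W x = w} := fun x => τ x
    have hτ' : ∀ k : ℕ, τ' ^ k = fun x => (τ ^ k) x := fun k => by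
      induction k with
      | zero => rfl
      | succ k ih => rw [pow_succ, ih, pow_succ]; rfl
    have hτ : τ' ^ p ^ 1 = 1 := by
      rw [hτ', pow_one, Equiv.Perm.subtypePerm_pow]
      refine funext fun x => ?_
      simp only [hσ]
      rfl
    have h1 := Equiv.Perm.card_fixedPoints_modEq (p := p) (n := 1) hτ
    have h2 : Fintype.card {x // W x = w} = (Finset.univ.filter fun x => W x = w).card :=
      Fintype.card_subtype _
    have h3 : Fintype.card (Function.fixedPoints τ) =
        ((Finset.univ.filter fun x => σ x = x).filter fun x => W x = w).card := by
      rw [Finset.filter_filter, ← Fintype.card_subtype]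
      refine Fintype.card_congr ⟨fun x => ⟨x.1.1, congrArg Subtype.val x.2, x.1.2⟩,
        fun x => ⟨⟨x.1, x.2.2⟩, Subtype.ext x.2.1⟩, fun _ => rfl, fun _ => rfl⟩
    rw [h2, h3] at h1
    have h4 : ∀ a b : ℕ, a ≡ b [MOD p] → a • w = b • w := by
      have h5 : ∀ a : ℕ, a • w = (a % p) • w := fun a => by
        conv_lhs => rw [← Nat.div_add_mod a p, add_smul, mul_comm, mul_smul, hQ, smul_zero, zero_add]
      intro a b hab
      rw [h5 a, h5 b, hab]
    exact h4 _ _ h1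
  · rw [Finset.card_eq_zero.2, zero_smul]
    refine Finset.filter_eq_empty_iff.2 fun x hx hxw => hw (Finset.mem_image.2 ⟨x, hx, hxw⟩)

theorem prod_ofFn_finRotate {R : Type*} [Monoid R] {n : ℕ} (f : Fin (n + 1) → R) :
    (List.ofFn fun i => f (finRotate (n + 1) i)).prod =
      (List.ofFn fun i : Fin n => f i.succ).prod * f 0 := by
  rw [List.ofFn_succ', List.concat_eq_append, List.prod_append]
  simp

theorem finRotate_pow_apply {n : ℕ} (k : ℕ) (i : Fin (n + 1)) :
    (finRotate (n + 1) ^ k) i = i + Fin.ofNat (n + 1) k := by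
  induction k with
  | zero => ext; simp
  | succ k ih =>
    rw [pow_succ', Equiv.Perm.mul_apply, ih, finRotate_apply, add_assoc]
    congr 1
    ext
    simp [Fin.val_add]

namespace IsTraceFunction

variable {R Q : Type*} [Ring R] [AddCommGroup Q] {t : R →+ Q}

/-- Expand the power into words in `x` and `y`, indexed by the set of positions of `x`. Cyclic
rotation does not change `t` of a word, so modulo `p` only the rotation-invariant words `x ^ p` and
`y ^ p` survive. -/
theorem map_add_pow (ht : IsTraceFunction t) {p : ℕ} [hp : Fact p.Prime]
    (hQ : ∀ z : Q, p • z = 0) (x y : R) : t ((x + y) ^ p) = t (x ^ p) + t (y ^ p) := by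
  classical
  obtain ⟨n, rfl⟩ : ∃ n, p = n + 1 := ⟨p - 1, by have := hp.out.pos; omega⟩
  let word : Finset (Fin (n + 1)) → Fin (n + 1) → R := fun s => s.piecewise (fun _ => x) fun _ => y
  let W : Finset (Fin (n + 1)) → Q := fun s => t (List.ofFn (word s)).prod
  have h1 : t ((x + y) ^ (n + 1)) = ∑ s, W s := by
    have := (MultilinearMap.mkPiAlgebraFin ℤ (n + 1) R).map_add_univ (fun _ => x) fun _ => y
    have h2 : ((fun _ => x) + fun _ => y : Fin (n + 1) → R) = fun _ => x + y := rfl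
    rw [h2, MultilinearMap.mkPiAlgebraFin_apply_const] at this
    rw [this, map_sum]
    rfl
  let σ : Equiv.Perm (Finset (Fin (n + 1))) := (finRotate (n + 1)).symm.finsetCongr
  have hmem : ∀ s i, i ∈ σ s ↔ finRotate (n + 1) i ∈ s := fun s i => by
    simp [σ, Equiv.finsetCongr_apply, Finset.mem_map_equiv]
  have hmem' : ∀ k s i, i ∈ (σ ^ k) s ↔ (finRotate (n + 1) ^ k) i ∈ s := by
    intro k
    induction k with
    | zero => simp
    | succ k ih => intro s i; rw [pow_succ', Equiv.Perm.mul_apply, hmem, ih, pow_succ]; rfl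
  have hσ : σ ^ (n + 1) = 1 := by
    ext s i
    rw [hmem', finRotate_pow_apply]
    simp
  have hword : ∀ s, word (σ s) = fun i => word s (finRotate (n + 1) i) := fun s => by
    ext i
    simp only [word, Finset.piecewise, hmem]
  have hW : ∀ s, W (σ s) = W s := fun s => by
    simp only [W, hword]
    rw [prod_ofFn_finRotate, ht, List.ofFn_succ, List.prod_cons]
  rw [h1, sum_eq_sum_fixedPoints hQ σ hσ W hW]
  have hfix : (Finset.univ.filter fun s => σ s = s) = {Finset.univ, ∅} := by
    ext s
    simp only [Finset.mem_filter, Finset.mem_univ, true_and, Finset.mem_insert,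
      Finset.mem_singleton]
    constructor
    · intro h
      have hk : ∀ k : ℕ, (σ ^ k) s = s := fun k => by
        induction k with
        | zero => rfl
        | succ k ih => rw [pow_succ', Equiv.Perm.mul_apply, ih, h]
      -- Rotations act transitively on positions, so a fixed set is everything or empty, according
      -- to whether it contains `0`.
      by_cases h0 : (0 : Fin (n + 1)) ∈ s
      · refine Or.inl (Finset.eq_univ_of_forall fun i => ?_)
        have := hmem' i.1 s 0
        rw [hk, finRotate_pow_apply] at this
        simpa using this.1 h0
      · refine Or.inr (Finset.eq_empty_of_forall_notMem fun i hi => h0 ?_)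
        have := hmem' i.1 s 0
        rw [hk, finRotate_pow_apply] at this
        exact this.2 (by simpa using hi)
    · rintro (rfl | rfl) <;> ext i <;> simp [hmem]
  rw [hfix, Finset.sum_pair (Finset.univ_nonempty.ne_empty)]
  simp [W, word, List.ofFn_const, -List.ofFn_succ]

theorem map_mul_pow (ht : IsTraceFunction t) (x y : R) (m : ℕ) :
    t ((x * y) ^ m) = t ((y * x) ^ m) := by
  cases m with
  | zero => simp
  | succ m =>
    have : (x * y) ^ (m + 1) = x * ((y * x) ^ m * y) := by
      rw [pow_succ, ← mul_assoc, mul_pow_mul, mul_assoc]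
    rw [this, ht, mul_assoc, ← pow_succ]

/-- Composing with a high `p`-power map kills nilpotent elements, which lets a trace function pass
to the quotient by a nil ideal. -/
theorem exists_pow (ht : IsTraceFunction t) {p : ℕ} [hp : Fact p.Prime]
    (hQ : ∀ z : Q, p • z = 0) (N : ℕ) :
    ∃ t' : R →+ Q, IsTraceFunction t' ∧ ∀ x, t' x = t (x ^ p ^ N) := by
  induction N with
  | zero => exact ⟨t, ht, by simp⟩
  | succ N ih =>
    obtain ⟨t', ht', h⟩ := ih
    refine ⟨AddMonoidHom.mk' (fun x => t' (x ^ p)) fun x y => ht'.map_add_pow hQ x y,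
      fun x y => ht'.map_mul_pow x y p, fun x => ?_⟩
    rw [AddMonoidHom.mk'_apply, h, ← pow_mul, pow_succ']

/-- Off-diagonal elementary matrices are commutators, and diagonal ones with the same entry agree up
to commutators; hence a trace function only sees the matrix trace. -/
theorem apply_eq_single {m : Type*} [Fintype m] [DecidableEq m] {t : Matrix m m R →+ Q}
    (ht : IsTraceFunction t) (i₀ : m) (M : Matrix m m R) :
    t M = t (Matrix.single i₀ i₀ M.trace) := by
  have h1 : ∀ i j (a : R), t (Matrix.single i j a) = if i = j then t (Matrix.single i₀ i₀ a) else 0 := by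
    intro i j a
    have h2 : Matrix.single i j a = Matrix.single i i₀ 1 * Matrix.single i₀ j a := by simp
    rw [h2, ht]
    split_ifs with h
    · subst h; simp
    · simp [Matrix.single_mul_single_of_ne _ _ _ _ (Ne.symm h)]
  conv_lhs => rw [Matrix.matrix_eq_sum_single M]
  have h2 : ∀ i, t (∑ j, Matrix.single i j (M i j)) = t (Matrix.single i₀ i₀ (M i i)) := fun i => by
    rw [map_sum, Finset.sum_congr rfl fun j _ => h1 i j (M i j), Finset.sum_ite_eq,
      if_pos (Finset.mem_univ _)]
  rw [map_sum, Finset.sum_congr rfl fun i _ => h2 i, ← map_sum]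
  exact congrArg t (map_sum (Matrix.singleAddMonoidHom (α := R) i₀ i₀) (fun i => M i i)
    Finset.univ).symm

end IsTraceFunction

/-- No eigenvalues are needed: `M ↦ trace (M ^ p ^ N)` is itself a trace function, so it can be
evaluated on the matrix with the single entry `trace M`. -/
theorem Matrix.trace_pow_char {m F : Type*} [Fintype m] [DecidableEq m] [Field F] (p : ℕ)
    [Fact p.Prime] [CharP F p] (M : Matrix m m F) (N : ℕ) :
    (M ^ p ^ N).trace = M.trace ^ p ^ N := by
  rcases isEmpty_or_nonempty m with h | ⟨⟨i₀⟩⟩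
  · have : p ^ N ≠ 0 := pow_ne_zero _ (Fact.out : p.Prime).ne_zero
    simp [Matrix.trace, zero_pow this]
  · have ht : IsTraceFunction (Matrix.traceAddMonoidHom m F) := fun x y => Matrix.trace_mul_comm x y
    obtain ⟨t', ht', h⟩ := ht.exists_pow (p := p) (fun z => by simp) N
    have := ht'.apply_eq_single i₀ M
    rw [h, h] at this
    simp only [Matrix.traceAddMonoidHom_apply] at this
    have hpow : ∀ (c : F) (k : ℕ), Matrix.single i₀ i₀ c ^ (k + 1) =
        Matrix.single i₀ i₀ (c ^ (k + 1)) := fun c k => by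
      induction k with
      | zero => simp
      | succ k ih => rw [pow_succ, ih, Matrix.single_mul_single_same, ← pow_succ]
    obtain ⟨k, hk⟩ := Nat.exists_eq_succ_of_ne_zero
      (pow_ne_zero N (Fact.out : p.Prime).ne_zero)
    rw [this, hk, Nat.succ_eq_add_one, hpow, Matrix.trace_single_eq_same]

/-! ### Trace functions on group algebras and products of matrix rings -/

theorem isTraceFunction_liftNC {F : Type u} [Field F] {A : Type v} [Group A] (f : A → F)
    (hf : ∀ g h, f (g * h) = f (h * g)) :
    IsTraceFunction (MonoidAlgebra.liftNC (AddMonoidHom.id F) f : MonoidAlgebra F A →+ F) := by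
  intro x y
  induction x using MonoidAlgebra.induction_linear with
  | zero => simp
  | add a b ha hb => rw [add_mul, mul_add, map_add, map_add, ha, hb]
  | single g c =>
    induction y using MonoidAlgebra.induction_linear with
    | zero => simp
    | add a b ha hb => rw [add_mul, mul_add, map_add, map_add, ha, hb]
    | single h e => simp [MonoidAlgebra.single_mul_single, hf g h, mul_comm c e]

theorem IsTraceFunction.eq_zero_of_trace_eq_zero {ι : Type} [Fintype ι] [DecidableEq ι]
    {D : ι → Type w} [∀ i, DivisionRing (D i)] {d : ι → ℕ} {Q : Type*} [AddCommGroup Q]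
    {t : PiMatrix D d →+ Q} (ht : IsTraceFunction t) (b : PiMatrix D d)
    (hb : ∀ i, (b i).trace = 0) : t b = 0 := by
  have h1 : b = ∑ i, Pi.single i (b i) := (Finset.univ_sum_single b).symm
  rw [h1, map_sum]
  refine Finset.sum_eq_zero fun i _ => ?_
  let ti : Matrix (Fin (d i)) (Fin (d i)) (D i) →+ Q :=
    t.comp (AddMonoidHom.single (fun i => Matrix (Fin (d i)) (Fin (d i)) (D i)) i)
  have hti : IsTraceFunction ti := fun x y => by
    change t (Pi.single i (x * y)) = t (Pi.single i (y * x))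
    rw [Pi.single_mul, Pi.single_mul, ht]
  change ti (b i) = 0
  rcases isEmpty_or_nonempty (Fin (d i)) with h | ⟨⟨i₀⟩⟩
  · rw [Subsingleton.elim (b i) 0, map_zero]
  · rw [hti.apply_eq_single i₀, hb, Matrix.single_zero, map_zero]

/-- If traces do not distinguish two elements of a group whose group algebra maps onto a product of
matrix rings with trivial kernel, then they are conjugate. -/
theorem isConj_of_trace_eq {F : Type u} [Field F] {A : Type v} [Group A] {ι : Type} [Fintype ι]
    [DecidableEq ι] {D : ι → Type w} [∀ i, DivisionRing (D i)] {d : ι → ℕ}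
    (ψ : MonoidAlgebra F A ≃+* PiMatrix D d) (g h : A)
    (hgh : ∀ i, (ψ (MonoidAlgebra.single g 1) i).trace = (ψ (MonoidAlgebra.single h 1) i).trace) :
    IsConj g h := by
  classical
  -- The indicator of the class of `g` extends to a trace function on the group algebra. Such a
  -- function depends only on the traces of the factors, so it agrees at `g` and `h`.
  let f : A → F := fun x => if IsConj g x then 1 else 0
  have hf : ∀ x y, f (x * y) = f (y * x) := fun x y => by
    have : IsConj (x * y) (y * x) := isConj_iff.2 ⟨y, by group⟩
    simp only [f, show IsConj g (x * y) ↔ IsConj g (y * x) from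
      ⟨fun h => h.trans this, fun h => h.trans this.symm⟩]
  have ht := isTraceFunction_liftNC f hf
  let t : PiMatrix D d →+ F :=
    (MonoidAlgebra.liftNC (AddMonoidHom.id F) f).comp ψ.symm.toAddEquiv.toAddMonoidHom
  have ht' : IsTraceFunction t := fun x y => by
    change MonoidAlgebra.liftNC _ f (ψ.symm (x * y)) = MonoidAlgebra.liftNC _ f (ψ.symm (y * x))
    rw [map_mul ψ.symm, map_mul ψ.symm, ht]
  have h1 := ht'.eq_zero_of_trace_eq_zero
    (ψ (MonoidAlgebra.single g 1) - ψ (MonoidAlgebra.single h 1))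
    (fun i => by rw [Pi.sub_apply, Matrix.trace_sub, hgh, sub_self])
  have h2 : ∀ x, t (ψ (MonoidAlgebra.single x 1)) = f x := fun x => by
    change MonoidAlgebra.liftNC _ f (ψ.symm (ψ _)) = _
    simp
  rw [map_sub, h2, h2, sub_eq_zero] at h1
  by_contra hc
  simp only [f, if_pos (IsConj.refl g), if_neg hc] at h1
  exact one_ne_zero h1

/-! ### Counting the simple modules of a finite group over a finite field -/

section Count

variable {k : Type u} [Field k] {p : ℕ} {A : Type v} [Group A]

/-- The conjugacy classes of elements of order prime to `p`. -/
abbrev PRegularClass (p : ℕ) (A : Type v) [Group A] : Type v :=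
  {C : ConjClasses A // ∀ a ∈ C.carrier, (orderOf a).Coprime p}

namespace PRegularClass

/-- A representative of a conjugacy class. -/
noncomputable def rep (C : PRegularClass p A) : A := Quotient.out C.1

theorem mk_rep (C : PRegularClass p A) : ConjClasses.mk C.rep = C.1 := Quotient.out_eq C.1

theorem coprime_rep (C : PRegularClass p A) : (orderOf C.rep).Coprime p :=
  C.2 _ (ConjClasses.mem_carrier_iff_mk_eq.2 C.mk_rep)

theorem exists_isConj_rep {g : A} (hg : (orderOf g).Coprime p) :
    ∃ C : PRegularClass p A, IsConj g C.rep := by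
  have h : ∀ a ∈ (ConjClasses.mk g).carrier, (orderOf a).Coprime p := fun a ha => by
    obtain ⟨c, hc⟩ := isConj_iff.1 (ConjClasses.mk_eq_mk_iff_isConj.1
      (ConjClasses.mem_carrier_iff_mk_eq.1 ha).symm)
    rw [← hc]
    have : orderOf (c * g * c⁻¹) = orderOf g := (MulAut.conj c).orderOf_eq g
    rwa [this]
  exact ⟨⟨ConjClasses.mk g, h⟩, ConjClasses.mk_eq_mk_iff_isConj.1 (mk_rep (p := p) ⟨_, h⟩).symm⟩

end PRegularClass

theorem isConj_pow_pow {q : ℕ} (hq : ∀ g : A, (orderOf g).Coprime p → IsConj g (g ^ q)) {g : A}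
    (hg : (orderOf g).Coprime p) (m : ℕ) : IsConj g (g ^ q ^ m) := by
  induction m with
  | zero => rw [pow_zero, pow_one]
  | succ m ih =>
    have : (orderOf (g ^ q ^ m)).Coprime p := Nat.Coprime.of_dvd_left (orderOf_pow_dvd _) hg
    rw [pow_succ, pow_mul]
    exact ih.trans (hq _ this)

variable {ι : Type} {D : ι → Type w} [∀ i, Field (D i)] [∀ i, Algebra k (D i)] {d : ι → ℕ}

/-- The vector of traces of the images in the factors of a product of matrix rings. -/
noncomputable def traceVector (ψ : MonoidAlgebra k A →ₐ[k] PiMatrix D d) : MonoidAlgebra k A →ₗ[k] ∀ i, D i :=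
  LinearMap.pi fun i => (Matrix.traceLinearMap (Fin (d i)) k (D i)).comp
    ((LinearMap.proj i).comp ψ.toLinearMap)

theorem traceVector_apply (ψ : MonoidAlgebra k A →ₐ[k] PiMatrix D d) (x : MonoidAlgebra k A)
    (i : ι) : traceVector ψ x i = (ψ x i).trace := rfl

theorem traceVector_surjective [∀ i, NeZero (d i)] {ψ : MonoidAlgebra k A →ₐ[k] PiMatrix D d}
    (hψ : Function.Surjective ψ) : Function.Surjective (traceVector ψ) := fun v => by
  obtain ⟨x, hx⟩ := hψ fun i => Matrix.single 0 0 (v i)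
  exact ⟨x, funext fun i => by rw [traceVector_apply, hx, Matrix.trace_single_eq_same]⟩

theorem traceVector_single_eq_of_isConj (ψ : MonoidAlgebra k A →ₐ[k] PiMatrix D d) {g h : A}
    (hgh : IsConj g h) :
    traceVector ψ (MonoidAlgebra.single g 1) = traceVector ψ (MonoidAlgebra.single h 1) := by
  obtain ⟨c, rfl⟩ := isConj_iff.1 hgh
  ext i
  have h1 : MonoidAlgebra.single (c * g * c⁻¹) (1 : k) =
      MonoidAlgebra.single c 1 * MonoidAlgebra.single (g * c⁻¹) 1 := by
    simp [MonoidAlgebra.single_mul_single, mul_assoc]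
  have h2 : MonoidAlgebra.single g (1 : k) =
      MonoidAlgebra.single (g * c⁻¹) 1 * MonoidAlgebra.single c 1 := by
    simp [MonoidAlgebra.single_mul_single]
  rw [h1, h2, traceVector_apply, traceVector_apply, map_mul, map_mul, Pi.mul_apply, Pi.mul_apply,
    Matrix.trace_mul_comm]

variable [Fact p.Prime] [CharP k p]

theorem traceVector_pow (ψ : MonoidAlgebra k A →ₐ[k] PiMatrix D d) (x : MonoidAlgebra k A)
    (N : ℕ) : traceVector ψ (x ^ p ^ N) = traceVector ψ x ^ p ^ N := by
  ext i
  have : CharP (D i) p := charP_of_injective_algebraMap (algebraMap k (D i)).injective p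
  rw [Pi.pow_apply, traceVector_apply, traceVector_apply, ← Matrix.trace_pow_char p, map_pow,
    Pi.pow_apply]

variable [Finite k] [Finite A]

/-- Let `T` be the trace vector, `s = g ^ q ^ a` and `Q = q ^ a`, with `a` so large that `s` is
`p`-regular. Then `T g ^ Q = T s`, and `T s = T s ^ Q` because `s` is conjugate to `s ^ Q`.
Frobenius is injective, so `T g = T s`. -/
theorem exists_coprime_traceVector_eq (ψ : MonoidAlgebra k A →ₐ[k] PiMatrix D d)
    (hq : ∀ g : A, (orderOf g).Coprime p → IsConj g (g ^ Nat.card k)) (g : A) :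
    ∃ C : PRegularClass p A,
      traceVector ψ (MonoidAlgebra.single g 1) = traceVector ψ (MonoidAlgebra.single C.rep 1) := by
  obtain ⟨f, hf0, hf⟩ : ∃ f, f ≠ 0 ∧ Nat.card k = p ^ f := by
    have := Fintype.ofFinite k
    obtain ⟨n, -, hn⟩ := FiniteField.card k p
    exact ⟨n, n.ne_zero, by rw [Nat.card_eq_fintype_card, hn]⟩
  have ho : orderOf g ≠ 0 := (orderOf_pos g).ne'
  obtain ⟨a, m, hm, ham⟩ := Nat.exists_eq_pow_mul_and_not_dvd ho p (Fact.out : p.Prime).ne_one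
  -- The exponent is a multiple of `p ^ a`, the `p`-part of the order of `g`.
  let s := g ^ Nat.card k ^ a
  have hs : (orderOf s).Coprime p := by
    refine Nat.Coprime.of_dvd_left (orderOf_dvd_of_pow_eq_one (n := m) ?_)
      ((Nat.Prime.coprime_iff_not_dvd Fact.out).2 hm).symm
    rw [← pow_mul, ← orderOf_dvd_iff_pow_eq_one, ham, hf, ← pow_mul]
    exact mul_dvd_mul_right (pow_dvd_pow _ (Nat.le_mul_of_pos_left _ (Nat.pos_of_ne_zero hf0))) _
  obtain ⟨C, hC⟩ := PRegularClass.exists_isConj_rep hs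
  refine ⟨C, ?_⟩
  rw [← traceVector_single_eq_of_isConj ψ hC]
  have h1 : ∀ x : A, traceVector ψ (MonoidAlgebra.single (x ^ Nat.card k ^ a) 1) =
      traceVector ψ (MonoidAlgebra.single x 1) ^ p ^ (f * a) := fun x => by
    rw [← traceVector_pow, MonoidAlgebra.single_pow, one_pow, hf, pow_mul]
  have h2 := h1 s
  rw [← traceVector_single_eq_of_isConj ψ (isConj_pow_pow hq hs a)] at h2
  have h3 := (h1 g).symm.trans h2
  ext i
  have : CharP (D i) p := charP_of_injective_algebraMap (algebraMap k (D i)).injective p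
  have h4 := congrFun h3 i
  exact iterateFrobenius_inj (D i) p (f * a) h4

/-- Both sides are `k`-linear in `x`, which reduces to `p`-regular group elements, where `g` and `g
^ q` are conjugate. It is used to show that the fields `D i` are no larger than `k`. -/
theorem traceVector_single_pow_card (ψ : MonoidAlgebra k A →ₐ[k] PiMatrix D d)
    (hq : ∀ g : A, (orderOf g).Coprime p → IsConj g (g ^ Nat.card k)) (x : MonoidAlgebra k A) :
    traceVector ψ x ^ Nat.card k = traceVector ψ x := by
  have := Fintype.ofFinite k
  obtain ⟨f, -, hf⟩ := FiniteField.card k p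
  rw [← Nat.card_eq_fintype_card] at hf
  induction x using MonoidAlgebra.induction_linear with
  | zero => rw [map_zero, zero_pow Nat.card_pos.ne']
  | add a b ha hb =>
    rw [map_add]
    nth_rw 2 [← ha, ← hb]
    ext i
    have : CharP (D i) p := charP_of_injective_algebraMap (algebraMap k (D i)).injective p
    simp only [Pi.pow_apply, Pi.add_apply, hf, add_pow_char_pow]
  | single g c =>
    have h1 : MonoidAlgebra.single g c = c • MonoidAlgebra.single g (1 : k) := by simp
    obtain ⟨C, hC⟩ := exists_coprime_traceVector_eq ψ hq g
    rw [h1, map_smul, hC, smul_pow, Nat.card_eq_fintype_card, FiniteField.pow_card,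
      ← Nat.card_eq_fintype_card]
    congr 1
    nth_rw 1 [hf]
    rw [← traceVector_pow, MonoidAlgebra.single_pow, one_pow, ← hf]
    exact (traceVector_single_eq_of_isConj ψ (hq _ C.coprime_rep)).symm

theorem span_traceVector_rep [∀ i, NeZero (d i)] {ψ : MonoidAlgebra k A →ₐ[k] PiMatrix D d}
    (hψ : Function.Surjective ψ)
    (hq : ∀ g : A, (orderOf g).Coprime p → IsConj g (g ^ Nat.card k)) :
    ⊤ ≤ Submodule.span k (Set.range fun C : PRegularClass p A =>
      traceVector ψ (MonoidAlgebra.single C.rep 1)) := by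
  rintro v -
  obtain ⟨x, rfl⟩ := traceVector_surjective hψ v
  induction x using MonoidAlgebra.induction_linear with
  | zero => simp
  | add a b ha hb => rw [map_add]; exact add_mem ha hb
  | single g c =>
    have : MonoidAlgebra.single g c = c • MonoidAlgebra.single g (1 : k) := by simp
    obtain ⟨C, hC⟩ := exists_coprime_traceVector_eq ψ hq g
    rw [this, map_smul, hC]
    exact Submodule.smul_mem _ _ (Submodule.subset_span ⟨C, rfl⟩)

variable [Fintype ι] [DecidableEq ι]

-- To isolate the coefficient at `C₀`, take the indicator `χ` of its class and set `t x = χ (x ^ q ^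
-- m)`. This trace function kills the nil kernel of `ψ`, so it factors through the matrix rings and
-- vanishes on a relation between traces. On `c • C.rep` it gives `c` if `C = C₀` and zero
-- otherwise, as `c ^ q = c` and `C.rep` is conjugate to its `q ^ m`-th power.
omit [Finite A] in
theorem linearIndependent_traceVector_rep {ψ : MonoidAlgebra k A →ₐ[k] PiMatrix D d}
    (hψ : Function.Surjective ψ) (hnil : ∃ m : ℕ, ∀ x, ψ x = 0 → x ^ m = 0)
    (hq : ∀ g : A, (orderOf g).Coprime p → IsConj g (g ^ Nat.card k)) :
    LinearIndependent k (fun C : PRegularClass p A =>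
      traceVector ψ (MonoidAlgebra.single C.rep 1)) := by
  classical
  have hQ : ∀ z : k, p • z = 0 := fun z => by simp
  have := Fintype.ofFinite k
  obtain ⟨f, -, hf⟩ := FiniteField.card k p
  rw [← Nat.card_eq_fintype_card] at hf
  obtain ⟨m, hm⟩ := hnil
  have hpow : Nat.card k ^ m = p ^ (f * m) := by rw [hf, pow_mul]
  -- This turns `x ^ m = 0` on the kernel into `x ^ q ^ m = 0`.
  have hmN : m ≤ p ^ (f * m) := by
    rw [← hpow]
    exact (Nat.lt_pow_self (Finite.one_lt_card)).le
  rw [linearIndependent_iff']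
  intro s c hc C₀ hC₀
  let χ : A → k := fun x => if IsConj C₀.rep x then 1 else 0
  have hχc : ∀ x y, IsConj x y → χ x = χ y := fun x y h => by
    simp only [χ, show IsConj C₀.rep x ↔ IsConj C₀.rep y from
      ⟨fun h' => h'.trans h, fun h' => h'.trans h.symm⟩]
  have hχ : ∀ x y, χ (x * y) = χ (y * x) := fun x y => hχc _ _ (isConj_iff.2 ⟨y, by group⟩)
  obtain ⟨t, ht, htp⟩ := (isTraceFunction_liftNC χ hχ).exists_pow hQ (f * m)
  have hker : ∀ x, ψ x = 0 → t x = 0 := fun x hx => by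
    rw [htp, ← Nat.add_sub_of_le hmN, pow_add, hm x hx, zero_mul, map_zero]
  choose r hr using hψ
  have hψt : ∀ x y, ψ x = ψ y → t x = t y := fun x y h => by
    rw [← sub_eq_zero, ← map_sub]
    exact hker _ (by rw [map_sub, h, sub_self])
  let t' : PiMatrix D d →+ k := AddMonoidHom.mk' (fun b => t (r b)) fun a b => by
    rw [← map_add]
    exact hψt _ _ (by rw [map_add, hr, hr, hr])
  have ht' : IsTraceFunction t' := fun a b => by
    change t (r (a * b)) = t (r (b * a))
    rw [hψt (r (a * b)) (r a * r b) (by rw [map_mul, hr, hr, hr]), ht]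
    exact hψt _ _ (by rw [map_mul, hr, hr, hr])
  let x : MonoidAlgebra k A := ∑ C ∈ s, c C • MonoidAlgebra.single C.rep 1
  have hx : traceVector ψ x = 0 := by
    rw [← hc]
    simp only [x, map_sum, map_smul]
  have h1 : t x = 0 := by
    rw [hψt x (r (ψ x)) (hr _).symm]
    exact ht'.eq_zero_of_trace_eq_zero (ψ x) fun i => congrFun hx i
  have h2 : ∀ C ∈ s, t (c C • MonoidAlgebra.single C.rep 1) = if C = C₀ then c C else 0 := by
    intro C _
    rw [htp, ← hpow, MonoidAlgebra.smul_single, smul_eq_mul, mul_one, MonoidAlgebra.single_pow,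
      MonoidAlgebra.liftNC_single, ← hχc _ _ (isConj_pow_pow hq C.coprime_rep m),
      Nat.card_eq_fintype_card, FiniteField.pow_card_pow, AddMonoidHom.id_apply]
    have h3 : IsConj C₀.rep C.rep ↔ C = C₀ := by
      rw [← ConjClasses.mk_eq_mk_iff_isConj, C.mk_rep, C₀.mk_rep, eq_comm, Subtype.ext_iff]
    simp only [χ, h3, mul_ite, mul_one, mul_zero]
  rw [map_sum, Finset.sum_congr rfl h2, Finset.sum_ite_eq', if_pos hC₀] at h1
  exact h1

/-- The representatives give a `k`-basis of the product of the `D i`, so the degrees of the `D i`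
over `k` add up to the number of classes; each degree is one. -/
theorem card_eq_numPRegularClasses [∀ i, NeZero (d i)] {ψ : MonoidAlgebra k A →ₐ[k] PiMatrix D d}
    (hψ : Function.Surjective ψ) (hnil : ∃ m : ℕ, ∀ x, ψ x = 0 → x ^ m = 0)
    (hq : ∀ g : A, (orderOf g).Coprime p → IsConj g (g ^ Nat.card k)) :
    Fintype.card ι = numPRegularClasses p A := by
  have hspan := span_traceVector_rep hψ hq
  have hli := linearIndependent_traceVector_rep hψ hnil hq
  have := Fintype.ofFinite k
  have hfin : Module.Finite k (∀ i, D i) := Module.Finite.of_basis (Module.Basis.mk hli hspan)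
  have hfinD : ∀ i, Module.Finite k (D i) := fun i => Module.Finite.of_surjective
    (LinearMap.proj (R := k) (φ := D) i) (Function.surjective_eval i)
  have h1 : ∀ i, Module.finrank k (D i) = 1 := fun i => by
    have : Finite (D i) := Module.finite_of_finite k
    -- The degree is the order of `y ↦ y ^ q`, which is the identity because every `y` occurs as a
    -- trace.
    rw [← FiniteField.orderOf_frobeniusAlgHom, orderOf_eq_one_iff]
    ext y
    obtain ⟨x, hx⟩ := traceVector_surjective hψ (Function.update 0 i y)
    have h2 := congrFun (traceVector_single_pow_card ψ hq x) i
    rw [hx, Pi.pow_apply, Function.update_self, Nat.card_eq_fintype_card] at h2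
    exact h2
  have h3 := Module.finrank_eq_nat_card_basis (Module.Basis.mk hli hspan)
  rw [Module.finrank_pi_fintype, Finset.sum_congr rfl fun i _ => h1 i] at h3
  rw [Finset.sum_const, smul_eq_mul, mul_one, Finset.card_univ] at h3
  exact h3

end Count

/-! ### Lifting idempotents over compact rings -/

/-- The matrices over an idempotent `e` form a nonempty compact subsemigroup, which contains an
idempotent by the Ellis–Numakura lemma. -/
theorem liftsMatrixIdempotents_of_compactSpace {R S : Type w} [Ring R] [Ring S]
    [TopologicalSpace R] [IsTopologicalRing R] [CompactSpace R] [T2Space R] {φ : R →+* S}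
    (hφ : Function.Surjective φ) (hc : ∀ s : S, IsClosed {r : R | φ r = s}) :
    LiftsMatrixIdempotents φ := by
  intro n e he
  have : T2Space (Matrix (Fin n) (Fin n) R) := inferInstanceAs (T2Space (Fin n → Fin n → R))
  have : CompactSpace (Matrix (Fin n) (Fin n) R) :=
    inferInstanceAs (CompactSpace (Fin n → Fin n → R))
  obtain ⟨E, hE, hEE⟩ := exists_idempotent_in_compact_subsemigroup
    (M := Matrix (Fin n) (Fin n) R) (fun r => by fun_prop) {E | E.map φ = e} (by
      choose g hg using hφ
      exact ⟨e.map g, by ext; simp [hg]⟩) (by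
      refine IsClosed.isCompact ?_
      have : {E : Matrix (Fin n) (Fin n) R | E.map φ = e} =
          ⋂ i, ⋂ j, (fun E => E i j) ⁻¹' {r | φ r = e i j} := by
        ext E
        simp [← Matrix.ext_iff]
      rw [this]
      exact isClosed_iInter fun i => isClosed_iInter fun j =>
        (hc _).preimage (by fun_prop)) (by
      rintro x (hx : x.map φ = e) y (hy : y.map φ = e)
      change (x * y).map φ = e
      rw [Matrix.map_mul, hx, hy, he])
  exact ⟨E, hEE, hE⟩

theorem liftsMatrixIdempotents_of_finite {R S : Type w} [Ring R] [Ring S] [Finite R] {φ : R →+* S}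
    (hφ : Function.Surjective φ) : LiftsMatrixIdempotents φ := by
  let : TopologicalSpace R := ⊥
  have : DiscreteTopology R := ⟨rfl⟩
  exact liftsMatrixIdempotents_of_compactSpace hφ fun s => isClosed_discrete _

/-! ### The Grothendieck group of a group algebra over a finite field -/

/-- A finite-dimensional algebra over a finite field maps onto a product of matrix algebras over
finite fields, with nilpotent kernel inside the Jacobson radical. -/
theorem exists_surjective_piMatrix (k : Type u) [Field k] [Finite k] (S : Type w) [Ring S]
    [Algebra k S] [Finite S] :
    ∃ (n : ℕ) (D : Fin n → Type w) (d : Fin n → ℕ) (_ : ∀ i, Field (D i))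
      (_ : ∀ i, Algebra k (D i)) (ψ : S →ₐ[k] PiMatrix D d), (∀ i, NeZero (d i)) ∧
      Function.Surjective ψ ∧ RingHom.ker ψ ≤ Ring.jacobson S ∧
      ∃ m : ℕ, ∀ x, ψ x = 0 → x ^ m = 0 := by
  have : Finite (S ⧸ Ring.jacobson S) := Finite.of_surjective _ Ideal.Quotient.mk_surjective
  have : Module.Finite k (S ⧸ Ring.jacobson S) := Module.Finite.of_finite
  obtain ⟨n, D, d, hD, hA, hfin, hd, ⟨e⟩⟩ :=
    IsSemisimpleRing.exists_algEquiv_pi_matrix_divisionRing_finite k (S ⧸ Ring.jacobson S)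
  have hfD : ∀ i, Finite (D i) := fun i => Module.finite_of_finite k
  let ψ : S →ₐ[k] PiMatrix D d := e.toAlgHom.comp (Ideal.Quotient.mkₐ k (Ring.jacobson S))
  have hker : ∀ x, ψ x = 0 → x ∈ Ring.jacobson S := fun x hx => by
    have : e (Ideal.Quotient.mk (Ring.jacobson S) x) = 0 := hx
    rwa [EmbeddingLike.map_eq_zero_iff, Ideal.Quotient.eq_zero_iff_mem] at this
  refine ⟨n, D, d, fun i => littleWedderburn (D i), hA, ψ, hd,
    e.surjective.comp (Ideal.Quotient.mk_surjective), hker, ?_⟩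
  obtain ⟨m, hm⟩ := IsSemiprimaryRing.isNilpotent (R := S)
  exact ⟨m, fun x hx => by
    have := Ideal.pow_mem_pow (hker x hx) m
    rw [hm] at this
    exact this⟩

theorem nonempty_K0_monoidAlgebra_equiv {k : Type u} [Field k] [Finite k] {p : ℕ} [Fact p.Prime]
    [CharP k p] {A : Type v} [Group A] [Finite A]
    (hq : ∀ g : A, (orderOf g).Coprime p → IsConj g (g ^ Nat.card k)) :
    Nonempty (K0 (MonoidAlgebra k A) ≃+ (Fin (numPRegularClasses p A) → ℤ)) := by
  have : Finite (MonoidAlgebra k A) :=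
    Finite.of_injective (fun x : MonoidAlgebra k A => (x.coeff : A → k))
      (DFunLike.coe_injective.comp (MonoidAlgebra.coeffEquiv (R := k) (M := A)).injective)
  obtain ⟨n, D, d, hD, hA, ψ, hd, hψ, hker, hnil⟩ :=
    exists_surjective_piMatrix k (MonoidAlgebra k A)
  obtain ⟨e, -⟩ := K0.exists_equiv_of_reduction (φ := ψ.toRingHom) hψ hker
    (liftsMatrixIdempotents_of_finite hψ)
  obtain ⟨e'⟩ := PiMatrix.nonempty_K0_equiv D d
  have hn := card_eq_numPRegularClasses hψ hnil hq
  rw [Fintype.card_fin] at hn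
  rw [← hn]
  exact ⟨e.trans e'⟩

/-! ### Frobenius invariance of traces -/

open Polynomial in
/-- The traces of the powers of a matrix of finite order are power sums of roots of unity. -/
theorem Matrix.exists_trace_pow_eq_sum {C m : Type*} [Field C] [IsAlgClosed C] [Fintype m]
    [DecidableEq m] {n : ℕ} (hn : (n : C) ≠ 0) (M : Matrix m m C) (hM : M ^ n = 1) :
    ∃ (s : Finset C) (r : C → ℕ), (∀ ζ ∈ s, ζ ^ n = 1) ∧
      ∀ j : ℕ, (M ^ j).trace = ∑ ζ ∈ s, (r ζ : C) * ζ ^ j := by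
  classical
  let f : Module.End C (m → C) := Matrix.toLin' M
  have hpow : ∀ j : ℕ, f ^ j = Matrix.toLin' (M ^ j) := fun j => (Matrix.toLin'_pow M j).symm
  have hfn : f ^ n = 1 := by rw [hpow, hM, Matrix.toLin'_one]; rfl
  -- `X ^ n - 1` is separable since `n ≠ 0` in `C`, so `f` is diagonalisable; `s` will be its set of
  -- eigenvalues and `r` their multiplicities.
  have hss : f.IsSemisimple := by
    refine Module.End.isSemisimple_of_squarefree_aeval_eq_zero (p := X ^ n - 1) ?_ ?_
    · have := (separable_X_pow_sub_C (1 : C) hn one_ne_zero).squarefree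
      simpa using this
    · simp [hfn]
  have hint : DirectSum.IsInternal f.eigenspace :=
    DirectSum.isInternal_submodule_of_iSupIndep_of_iSup_eq_top f.eigenspaces_iSupIndep
      hss.iSup_eigenspace_eq_top
  have hfin : {ζ | f.eigenspace ζ ≠ ⊥}.Finite :=
    WellFoundedGT.finite_ne_bot_of_iSupIndep f.eigenspaces_iSupIndep
  have hfx : ∀ j : ℕ, ∀ ζ, ∀ x ∈ f.eigenspace ζ, (f ^ j) x = ζ ^ j • x := by
    intro j ζ x hx
    induction j with
    | zero => simp
    | succ j ih =>
      rw [pow_succ', Module.End.mul_apply, ih, map_smul, Module.End.mem_eigenspace_iff.1 hx,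
        smul_smul, pow_succ]
  refine ⟨hfin.toFinset, fun ζ => Module.finrank C (f.eigenspace ζ), fun ζ hζ => ?_, fun j => ?_⟩
  · obtain ⟨x, hx, hx0⟩ := Submodule.exists_mem_ne_zero_of_ne_bot (hfin.mem_toFinset.1 hζ)
    have h1 := hfx n ζ x hx
    rw [hfn, Module.End.one_apply] at h1
    have h2 : (ζ ^ n - 1) • x = 0 := by rw [sub_smul, ← h1, one_smul, sub_self]
    exact sub_eq_zero.1 ((smul_eq_zero.1 h2).resolve_right hx0)
  · have hmaps : ∀ ζ, Set.MapsTo (f ^ j) (f.eigenspace ζ) (f.eigenspace ζ) := fun ζ x hx => by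
      rw [SetLike.mem_coe, hfx j ζ x hx]
      exact Submodule.smul_mem _ _ hx
    rw [← Matrix.trace_toLin'_eq, ← hpow,
      LinearMap.trace_eq_sum_trace_restrict' hint hfin hmaps]
    refine Finset.sum_congr rfl fun ζ _ => ?_
    have : (f ^ j).restrict (hmaps ζ) = ζ ^ j • LinearMap.id := by
      ext x : 2
      exact hfx j ζ x x.2
    rw [this, map_smul, LinearMap.trace_id, smul_eq_mul, mul_comm]

/-- A finite Galois extension has an automorphism that raises the roots of unity of order prime to
the residue characteristic to the power of the cardinality of the residue field. -/
theorem exists_frobenius (A : Type*) {K : Type*} (L : Type*) [CommRing A] [IsDomain A]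
    [IsLocalRing A] [IsNoetherianRing A] [IsIntegrallyClosed A] [Field K] [Field L] [Algebra A K]
    [IsFractionRing A K] [Algebra K L] [Algebra A L] [IsScalarTower A K L] [FiniteDimensional K L]
    [IsGalois K L] [Finite (IsLocalRing.ResidueField A)] {n : ℕ} (hn : IsUnit (n : A)) :
    ∃ σ : L →ₐ[K] L, ∀ ζ : L, ζ ^ n = 1 →
      σ ζ = ζ ^ Nat.card (IsLocalRing.ResidueField A) := by
  let B := integralClosure A L
  have hfin : Module.Finite A B := IsIntegralClosure.finite A K L B
  have hinj : Function.Injective (algebraMap A B) := by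
    refine Function.Injective.of_comp (f := algebraMap B L) ?_
    rw [← RingHom.coe_comp, ← IsScalarTower.algebraMap_eq, IsScalarTower.algebraMap_eq A K L]
    exact (algebraMap K L).injective.comp (IsFractionRing.injective A K)
  obtain ⟨Q, hQ, hQA⟩ := Ideal.exists_ideal_over_maximal_of_isIntegral (S := B)
    (IsLocalRing.maximalIdeal A) (by rw [(RingHom.injective_iff_ker_eq_bot _).1 hinj]; exact bot_le)
  have hover : Q.under A = IsLocalRing.maximalIdeal A := hQA
  have hk : Finite (A ⧸ Q.under A) := by
    rw [hover]; exact inferInstanceAs (Finite (IsLocalRing.ResidueField A))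
  have hBQ : Finite (B ⧸ Q) := by
    have : Module.Finite A (B ⧸ Q) := inferInstance
    have : Module.Finite (A ⧸ Q.under A) (B ⧸ Q) := Module.Finite.of_restrictScalars_finite A _ _
    exact Module.finite_of_finite (A ⧸ Q.under A)
  have hfrac : IsFractionRing B L := integralClosure.isFractionRing_of_finite_extension K L
  let _ : MulSemiringAction Gal(L/K) B := IsIntegralClosure.MulSemiringAction A K L B
  have : Algebra.IsInvariant A B Gal(L/K) := Algebra.isInvariant_of_isGalois A K L B
  have : SMulCommClass Gal(L/K) A B := ⟨fun g a b => map_smul (galRestrict A K L B g) a b⟩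
  -- `σ` induces the `q`-th power map modulo `Q`. Since `n` is a unit, distinct `n`-th roots of
  -- unity stay distinct modulo `Q`, so on them the congruence is an equality.
  obtain ⟨σ, hσ⟩ := IsArithFrobAt.exists_of_isInvariant A Gal(L/K) Q
  refine ⟨σ, fun ζ hζ => ?_⟩
  have hn0 : n ≠ 0 := by
    rintro rfl
    simp at hn
  have hint : IsIntegral A ζ := ⟨Polynomial.X ^ n - 1, by
    simpa using Polynomial.monic_X_pow_sub_C (1 : A) hn0, by simp [hζ]⟩
  have h1 := hσ.apply_of_pow_eq_one (ζ := (⟨ζ, hint⟩ : B)) (m := n) (Subtype.ext hζ) (by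
    intro h
    refine hQ.ne_top (Ideal.eq_top_of_isUnit_mem _ h ?_)
    simpa using hn.map (algebraMap A B))
  have h2 := congrArg (algebraMap B L) h1
  rw [hover] at h2
  exact (algebraMap_galRestrict_apply A σ (⟨ζ, hint⟩ : B)).symm.trans h2

open Polynomial in
/-- The trace of a matrix of finite order prime to the residue characteristic agrees with the trace
of its power by the cardinality of the residue field. -/
theorem Matrix.trace_pow_card_residueField (A : Type*) {K m : Type*} [CommRing A] [IsDomain A]
    [IsLocalRing A] [IsNoetherianRing A] [IsIntegrallyClosed A] [Field K] [Algebra A K]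
    [IsFractionRing A K] [Finite (IsLocalRing.ResidueField A)] [Fintype m] [DecidableEq m] {n : ℕ}
    (hn : IsUnit (n : A)) (M : Matrix m m K) (hM : M ^ n = 1) :
    (M ^ Nat.card (IsLocalRing.ResidueField A)).trace = M.trace := by
  have hnK : (n : K) ≠ 0 := by
    have := (hn.map (algebraMap A K)).ne_zero
    rwa [map_natCast] at this
  have hsep := separable_X_pow_sub_C (1 : K) hnK one_ne_zero
  let E := (X ^ n - C (1 : K)).SplittingField
  have hgal : IsGalois K E := IsGalois.of_separable_splitting_field hsep
  obtain ⟨σ, hσ⟩ := exists_frobenius (K := K) A E hn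
  let F := AlgebraicClosure E
  let j := algebraMap E F
  let i := algebraMap K F
  have hnF : (n : F) ≠ 0 := by
    have := (map_ne_zero i).2 hnK
    rwa [map_natCast] at this
  have hpow : ∀ a : ℕ, (M.map i) ^ a = (M ^ a).map i := fun a => (map_pow i.mapMatrix M a).symm
  obtain ⟨s, r, hs, htr⟩ := Matrix.exists_trace_pow_eq_sum hnF (M.map i) (by
    rw [hpow, hM]; exact map_one i.mapMatrix)
  -- The eigenvalues live in the algebraic closure `F`; being `n`-th roots of unity they come from
  -- `E`, where `σ` acts. The value `0` at other `ζ` is never used.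
  have hroot : ∀ ζ : F, ∃ ξ : E, ζ ^ n = 1 → j ξ = ζ ∧ ξ ^ n = 1 := fun ζ => by
    by_cases h : ζ ^ n = 1
    · have h1 : ((X ^ n - C (1 : K)).map (algebraMap K E)).Splits := SplittingField.splits _
      obtain ⟨x, hx⟩ := h1.mem_range_of_isRoot
        ((Polynomial.map_ne_zero_iff (algebraMap K E).injective).2 hsep.ne_zero)
        (i := j) (x := ζ) (by simp [h])
      refine ⟨x, fun _ => ⟨hx, j.injective ?_⟩⟩
      rw [map_pow, hx, h]
      exact (map_one j).symm
    · exact ⟨0, fun h' => absurd h' h⟩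
  choose ξ hξ using hroot
  have hE : ∀ a : ℕ, algebraMap K E (M ^ a).trace = ∑ ζ ∈ s, (r ζ : E) * ξ ζ ^ a := fun a => by
    apply j.injective
    have h1 := htr a
    rw [hpow, ← AddMonoidHom.map_trace i] at h1
    rw [map_sum, ← IsScalarTower.algebraMap_apply K E F]
    refine h1.trans (Finset.sum_congr rfl fun ζ hζ => ?_)
    rw [map_mul, map_natCast, map_pow, (hξ ζ (hs ζ hζ)).1]
  apply (algebraMap K E).injective
  -- `σ` fixes `trace M`, which lies in `K`, and raises each eigenvalue to the power `q`.
  rw [hE, ← pow_one M, ← σ.commutes, hE, map_sum]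
  refine Finset.sum_congr rfl fun ζ hζ => ?_
  rw [map_mul, map_natCast, pow_one, hσ _ (hξ ζ (hs ζ hζ)).2]

/-! ### Conjugacy classes over a splitting field -/

/-- The Wedderburn components of the group algebra over a splitting field are split. -/
theorem IsSplittingFieldFor.algebraMap_surjective {F : Type u} [Field F] {A : Type v} [Group A]
    (hF : IsSplittingFieldFor F A) {ι : Type} [DecidableEq ι] {D : ι → Type max u v}
    [∀ i, DivisionRing (D i)] [∀ i, Algebra F (D i)] {d : ι → ℕ} [∀ i, NeZero (d i)]
    (e : MonoidAlgebra F A ≃ₐ[F] PiMatrix D d) (i : ι) :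
    Function.Surjective (algebraMap F (D i)) := by
  intro δ
  let _ : Module (MonoidAlgebra F A) (PiMatrix.Column D d i) :=
    Module.compHom _ (e : MonoidAlgebra F A →+* PiMatrix D d)
  have hsmul : ∀ (a : MonoidAlgebra F A) (x : PiMatrix.Column D d i), a • x = e a • x :=
    fun _ _ => rfl
  have : IsSimpleModule (MonoidAlgebra F A) (PiMatrix.Column D d i) := by
    refine isSimpleModule_iff_toSpanSingleton_surjective.2
      ⟨IsSimpleModule.nontrivial (PiMatrix D d) _, fun x hx y => ?_⟩
    obtain ⟨b, hb⟩ := PiMatrix.exists_smul_eq D d i hx y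
    exact ⟨e.symm b, by rw [LinearMap.toSpanSingleton_apply, hsmul, e.apply_symm_apply, hb]⟩
  -- Right multiplication by `δ` commutes with the left action, so it is a scalar `c`; evaluating at
  -- a unit vector gives `δ = c`.
  let f : PiMatrix.Column D d i →ₗ[MonoidAlgebra F A] PiMatrix.Column D d i :=
    { toFun := fun x j => x j * δ
      map_add' := fun x y => funext fun j => add_mul (x j) (y j) δ
      map_smul' := fun a x => by
        refine funext fun j => ?_
        change (∑ l, e a i j l * x l) * δ = ∑ l, e a i j l * (x l * δ)
        simp only [Finset.sum_mul, mul_assoc] }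
  obtain ⟨c, hc⟩ := hF (PiMatrix.Column D d i) f
  refine ⟨c, ?_⟩
  let x : Fin (d i) → D i := Pi.single 0 1
  have h1 : f x = e (algebraMap F (MonoidAlgebra F A) c) •
      (show PiMatrix.Column D d i from x) := hc x
  rw [AlgEquiv.commutes, PiMatrix.Column.smul_def] at h1
  have h2 : x 0 * δ = Matrix.mulVec (algebraMap F (PiMatrix D d) c i) x 0 := congrFun h1 0
  rw [Pi.algebraMap_apply, Matrix.algebraMap_eq_diagonal, Matrix.mulVec_diagonal] at h2
  simpa [x] using h2.symm

/-- Over a splitting field of characteristic zero, an element of order prime to the residue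
characteristic is conjugate to its power by the cardinality of the residue field. -/
theorem IsSplittingFieldFor.isConj_pow (O : Type*) {F : Type u} [CommRing O] [IsDomain O]
    [IsLocalRing O] [IsNoetherianRing O] [IsIntegrallyClosed O] [Field F] [CharZero F] [Algebra O F]
    [IsFractionRing O F] [Finite (IsLocalRing.ResidueField O)] {A : Type v} [Group A] [Finite A]
    (hF : IsSplittingFieldFor F A) (g : A) (hg : IsUnit (orderOf g : O)) :
    IsConj g (g ^ Nat.card (IsLocalRing.ResidueField O)) := by
  have : NeZero (Nat.card A : F) := ⟨Nat.cast_ne_zero.2 Nat.card_pos.ne'⟩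
  obtain ⟨n, D, d, hD, hA, hd, ⟨e⟩⟩ :=
    IsSemisimpleRing.exists_algEquiv_pi_matrix_divisionRing F (MonoidAlgebra F A)
  have hbij : ∀ i, Function.Bijective (algebraMap F (D i)) := fun i =>
    ⟨(algebraMap F (D i)).injective, hF.algebraMap_surjective e i⟩
  refine isConj_of_trace_eq (e : MonoidAlgebra F A ≃+* PiMatrix D d) _ _ fun i => ?_
  let ε : D i ≃+* F := (RingEquiv.ofBijective (algebraMap F (D i)) (hbij i)).symm
  let μ : Matrix (Fin (d i)) (Fin (d i)) (D i) →+* Matrix (Fin (d i)) (Fin (d i)) F :=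
    (ε : D i →+* F).mapMatrix
  have htr : ∀ M, ε M.trace = (μ M).trace := fun M => AddMonoidHom.map_trace (ε : D i →+* F) M
  apply ε.injective
  have hpow : ∀ a : ℕ, MonoidAlgebra.single (g ^ a) (1 : F) = MonoidAlgebra.single g 1 ^ a := by
    simp [MonoidAlgebra.single_pow]
  change ε (e (MonoidAlgebra.single g 1) i).trace = ε (e (MonoidAlgebra.single (g ^ _) 1) i).trace
  rw [htr, htr, hpow, map_pow, Pi.pow_apply, map_pow]
  refine (Matrix.trace_pow_card_residueField O hg _ ?_).symm
  rw [← map_pow, ← Pi.pow_apply, ← map_pow, ← hpow, pow_orderOf_eq_one, ← MonoidAlgebra.one_def,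
    map_one, Pi.one_apply, map_one]

/-! ### The ring of integers of a `p`-adic field -/

section IntegerRing

variable (K : Type u) [NormedField K] [IsUltrametricDist K]

theorem mem_integerRing_iff {x : K} : x ∈ IntegerRing K ↔ ‖x‖ ≤ 1 := by
  rw [Valuation.mem_valuationSubring_iff]
  exact Iff.rfl

theorem mem_maximalIdeal_integerRing_iff (x : IntegerRing K) :
    x ∈ IsLocalRing.maximalIdeal (IntegerRing K) ↔ ‖(x : K)‖ < 1 := by
  have hx : ‖(x : K)‖ ≤ 1 := (mem_integerRing_iff K).1 x.2
  rw [IsLocalRing.mem_maximalIdeal, mem_nonunits_iff, hx.lt_iff_ne, not_iff_not]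
  constructor
  · intro h
    obtain ⟨y, hy⟩ := h.exists_right_inv
    have h1 : ‖(x : K)‖ * ‖(y : K)‖ = 1 := by
      rw [← norm_mul, ← norm_one (α := K)]
      exact congrArg (fun z : IntegerRing K => ‖(z : K)‖) hy
    have h2 : ‖(y : K)‖ ≤ 1 := (mem_integerRing_iff K).1 y.2
    nlinarith [norm_nonneg (x : K), norm_nonneg (y : K)]
  · intro h
    have h0 : (x : K) ≠ 0 := norm_ne_zero_iff.1 (by rw [h]; exact one_ne_zero)
    refine IsUnit.of_mul_eq_one ⟨(x : K)⁻¹, ?_⟩ (Subtype.ext (mul_inv_cancel₀ h0))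
    rw [mem_integerRing_iff, norm_inv, h, inv_one]

theorem compactSpace_integerRing [ProperSpace K] : CompactSpace (IntegerRing K) := by
  refine isCompact_iff_compactSpace.1 (?_ : IsCompact (IntegerRing K : Set K))
  convert isCompact_closedBall (0 : K) 1 using 1
  ext x
  rw [SetLike.mem_coe, mem_integerRing_iff, mem_closedBall_zero_iff]

theorem isOpen_maximalIdeal_integerRing :
    IsOpen (IsLocalRing.maximalIdeal (IntegerRing K) : Set (IntegerRing K)) := by
  have : (IsLocalRing.maximalIdeal (IntegerRing K) : Set (IntegerRing K)) =
      {x : IntegerRing K | ‖(x : K)‖ < 1} := by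
    ext x
    exact mem_maximalIdeal_integerRing_iff K x
  rw [this]
  exact isOpen_lt (by fun_prop) continuous_const

theorem finite_integerResidueField [ProperSpace K] : Finite (IntegerResidueField K) := by
  have := compactSpace_integerRing K
  have : DiscreteTopology (IntegerRing K ⧸ (IsLocalRing.maximalIdeal (IntegerRing K)).toAddSubgroup) :=
    QuotientAddGroup.discreteTopology (isOpen_maximalIdeal_integerRing K)
  exact (finite_of_compact_of_discrete :
    Finite (IntegerRing K ⧸ (IsLocalRing.maximalIdeal (IntegerRing K)).toAddSubgroup))

/-- Supplies the Noetherian hypothesis of `exists_frobenius`, which makes the integral closure a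
finite module. -/
theorem isPrincipalIdealRing_integerRing [ProperSpace K] :
    IsPrincipalIdealRing (IntegerRing K) := by
  let _ : Valued K NNReal := NormedField.toValued
  have : CompactSpace (Valued.integer K) := compactSpace_integerRing K
  exact (Valued.integer.isPrincipalIdealRing_of_compactSpace : IsPrincipalIdealRing (Valued.integer K))

end IntegerRing

/-! ### The radical of a group algebra over a local ring -/

theorem MonoidAlgebra.sum_single_coeff {A : Type u} [CommRing A] {Γ : Type v} [Fintype Γ] (x : MonoidAlgebra A Γ) :
    ∑ γ, MonoidAlgebra.single γ (x.coeff γ) = x := by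
  conv_rhs => rw [← MonoidAlgebra.sum_coeff_single x]
  exact (Finsupp.sum_fintype _ _ fun γ => MonoidAlgebra.single_zero γ).symm

section Radical

variable {A : Type u} [CommRing A] [IsLocalRing A] {Γ : Type v} [Group Γ]

/-- An element of the maximal ideal annihilates the simple quotients of a group algebra of a finite
group over a local ring. -/
theorem MonoidAlgebra.single_one_smul_eq_zero [Finite Γ] (I : Ideal (MonoidAlgebra A Γ))
    [I.IsMaximal] {a : A} (ha : a ∈ IsLocalRing.maximalIdeal A) (v : MonoidAlgebra A Γ ⧸ I) :
    (MonoidAlgebra.single 1 a : MonoidAlgebra A Γ) • v = 0 := by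
  have hcomm : ∀ r : MonoidAlgebra A Γ, MonoidAlgebra.single 1 a * r = r * MonoidAlgebra.single 1 a :=
    fun r => MonoidAlgebra.single_one_comm a r
  let V := MonoidAlgebra A Γ ⧸ I
  have : IsSimpleModule (MonoidAlgebra A Γ) V := isSimpleModule_iff_isCoatom.2 (Ideal.isMaximal_def.1 ‹_›)
  let f : V →ₗ[MonoidAlgebra A Γ] V :=
    { toFun := fun v => (MonoidAlgebra.single 1 a : MonoidAlgebra A Γ) • v
      map_add' := smul_add _
      map_smul' := fun r v => by rw [smul_smul, hcomm, ← smul_smul, RingHom.id_apply] }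
  -- Schur's lemma for multiplication by the central element `a`. If it were bijective, `V` would
  -- equal the maximal ideal times `V`, contradicting Nakayama over `A`.
  rcases f.bijective_or_eq_zero with hf | hf
  · exfalso
    have hfin : Module.Finite A (MonoidAlgebra A Γ) := Module.Finite.of_basis (MonoidAlgebra.basis Γ A)
    have hfinV : Module.Finite A V := Module.Finite.of_surjective
      (I.mkQ.restrictScalars A) I.mkQ_surjective
    have hle : (⊤ : Submodule A V) ≤ IsLocalRing.maximalIdeal A • ⊤ := by
      rintro v -
      obtain ⟨w, rfl⟩ := hf.2 v
      have : f w = a • w := by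
        change (MonoidAlgebra.single 1 a : MonoidAlgebra A Γ) • w = a • w
        rw [← mul_one a, ← smul_eq_mul, ← MonoidAlgebra.smul_single, smul_assoc,
          ← MonoidAlgebra.one_def, one_smul, smul_eq_mul, mul_one]
      rw [this]
      exact Submodule.smul_mem_smul ha trivial
    have h := Submodule.eq_bot_of_le_smul_of_le_jacobson_bot _ ⊤ Module.Finite.fg_top hle
      (IsLocalRing.jacobson_eq_maximalIdeal _ bot_ne_top).ge
    have := IsSimpleModule.nontrivial (MonoidAlgebra A Γ) V
    exact bot_ne_top h.symm
  · exact LinearMap.congr_fun hf v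

theorem MonoidAlgebra.finite_quotient_of_isMaximal [Finite Γ]
    [Finite (IsLocalRing.ResidueField A)] (I : Ideal (MonoidAlgebra A Γ)) [I.IsMaximal] :
    Finite (MonoidAlgebra A Γ ⧸ I) := by
  have := Fintype.ofFinite Γ
  choose r hr using IsLocalRing.residue_surjective (R := A)
  let q : (Γ → IsLocalRing.ResidueField A) → MonoidAlgebra A Γ ⧸ I := fun c =>
    ∑ γ, I.mkQ (MonoidAlgebra.single γ (r (c γ)))
  refine Finite.of_surjective q fun v => ?_
  obtain ⟨x, rfl⟩ := I.mkQ_surjective v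
  refine ⟨fun γ => IsLocalRing.residue A (x.coeff γ), ?_⟩
  conv_rhs => rw [← MonoidAlgebra.sum_single_coeff x, map_sum]
  refine Finset.sum_congr rfl fun γ _ => ?_
  rw [← sub_eq_zero, ← map_sub, ← MonoidAlgebra.single_sub]
  have hmem : r (IsLocalRing.residue A (x.coeff γ)) - x.coeff γ ∈ IsLocalRing.maximalIdeal A := by
    rw [← IsLocalRing.residue_eq_zero_iff, map_sub, hr, sub_self]
  have h0 := MonoidAlgebra.single_one_smul_eq_zero I hmem (I.mkQ (MonoidAlgebra.single γ 1))
  rwa [← map_smul, smul_eq_mul, MonoidAlgebra.single_mul_single, one_mul, mul_one] at h0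

/-- A `p`-subgroup that is normal acts trivially on the simple quotients of a group algebra over a
local ring with finite residue field of characteristic `p`. -/
theorem MonoidAlgebra.single_smul_eq_self [Finite Γ] [Finite (IsLocalRing.ResidueField A)] {p : ℕ}
    [Fact p.Prime] (hp : (p : A) ∈ IsLocalRing.maximalIdeal A) (P : Subgroup Γ) [P.Normal]
    (hP : IsPGroup p P) (I : Ideal (MonoidAlgebra A Γ)) [I.IsMaximal] {h : Γ} (hh : h ∈ P)
    (v : MonoidAlgebra A Γ ⧸ I) : (MonoidAlgebra.single h 1 : MonoidAlgebra A Γ) • v = v := by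
  let V := MonoidAlgebra A Γ ⧸ I
  have : IsSimpleModule (MonoidAlgebra A Γ) V := isSimpleModule_iff_isCoatom.2 (Ideal.isMaximal_def.1 ‹_›)
  have : Nontrivial V := IsSimpleModule.nontrivial (MonoidAlgebra A Γ) V
  have : Finite V := MonoidAlgebra.finite_quotient_of_isMaximal I
  let _ : MulAction P V := MulAction.compHom V ((MonoidAlgebra.of A Γ).comp P.subtype)
  have hact : ∀ (g : P) (w : V), g • w = (MonoidAlgebra.single (g : Γ) 1 : MonoidAlgebra A Γ) • w :=
    fun _ _ => rfl
  have hpV : p ∣ Nat.card V := by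
    obtain ⟨w, hw⟩ := exists_ne (0 : V)
    have h0 : p • w = 0 := by
      have := MonoidAlgebra.single_one_smul_eq_zero I hp w
      rwa [← MonoidAlgebra.natCast_def, Nat.cast_smul_eq_nsmul] at this
    rw [← addOrderOf_eq_prime h0 hw]
    exact addOrderOf_dvd_natCard w
  -- A `p`-group acting on a set of cardinality divisible by `p` and fixing `0` fixes another point.
  -- The fixed points form a submodule because `P` is normal, hence all of `V` by simplicity.
  obtain ⟨w, hw, hw0⟩ := hP.exists_fixed_point_of_prime_dvd_card_of_fixed_point V hpV
    (a := 0) (fun g => by rw [hact, smul_zero])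
  let F : Submodule (MonoidAlgebra A Γ) V :=
    { carrier := {u | ∀ g ∈ P, (MonoidAlgebra.single g 1 : MonoidAlgebra A Γ) • u = u}
      add_mem' := fun ha hb g hg => by rw [smul_add, ha g hg, hb g hg]
      zero_mem' := fun g _ => smul_zero _
      smul_mem' := fun r u hu g hg => by
        induction r using MonoidAlgebra.induction_linear with
        | zero => simp
        | add x y hx hy => rw [add_smul, smul_add, hx, hy]
        | single γ a =>
          have h1 : (MonoidAlgebra.single g 1 : MonoidAlgebra A Γ) * MonoidAlgebra.single γ a =
              MonoidAlgebra.single γ a * MonoidAlgebra.single (γ⁻¹ * g * γ) 1 := by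
            simp [MonoidAlgebra.single_mul_single, mul_assoc]
          have h2 : γ⁻¹ * g * γ ∈ P := by simpa using Subgroup.Normal.conj_mem ‹_› g hg γ⁻¹
          rw [smul_smul, h1, ← smul_smul, hu _ h2] }
  have hF : F = ⊤ := (eq_bot_or_eq_top F).resolve_left fun hF => by
    have : w ∈ F := fun g hg => hw ⟨g, hg⟩
    rw [hF] at this
    exact hw0 ((Submodule.mem_bot _).1 this).symm
  have : v ∈ F := hF ▸ Submodule.mem_top
  exact this h hh

/-- The kernel of the reduction of the group algebra of a finite group modulo the maximal ideal and
a normal `p`-subgroup is contained in the Jacobson radical. -/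
theorem MonoidAlgebra.mem_jacobson_of_map_eq_zero [Finite Γ] [Finite (IsLocalRing.ResidueField A)]
    {p : ℕ} [Fact p.Prime] (hp : (p : A) ∈ IsLocalRing.maximalIdeal A) {Δ : Type*} [Group Δ]
    (f : Γ →* Δ) (hf : Function.Surjective f) (hker : IsPGroup p f.ker) {x : MonoidAlgebra A Γ}
    (hx : MonoidAlgebra.mapRingHom Δ (IsLocalRing.residue A)
      (MonoidAlgebra.mapDomainRingHom A f x) = 0) : x ∈ Ring.jacobson (MonoidAlgebra A Γ) := by
  rw [Ring.jacobson_eq_sInf_isMaximal, Submodule.mem_sInf]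
  intro I hI
  have : Ideal.IsMaximal I := hI
  choose s hs using hf
  let v : MonoidAlgebra A Γ ⧸ I := Submodule.Quotient.mk 1
  -- `γ` and `s (f γ)` differ by an element of the kernel of `f`, which acts trivially; so `x` may
  -- be replaced by its image in `A[Δ]` transported along the section `s`, whose coefficients lie in
  -- the maximal ideal.
  have h1 : x • v = MonoidAlgebra.mapDomain s (MonoidAlgebra.mapDomain f x) • v := by
    clear hx
    induction x using MonoidAlgebra.induction_linear with
    | zero => simp
    | add a b ha hb => rw [add_smul, ha, hb, MonoidAlgebra.mapDomain_add, MonoidAlgebra.mapDomain_add, add_smul]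
    | single γ a =>
      have hmem : (s (f γ))⁻¹ * γ ∈ f.ker := by simp [MonoidHom.mem_ker, hs]
      have h2 : (MonoidAlgebra.single γ a : MonoidAlgebra A Γ) =
          MonoidAlgebra.single (s (f γ)) a * MonoidAlgebra.single ((s (f γ))⁻¹ * γ) 1 := by
        simp [MonoidAlgebra.single_mul_single]
      rw [MonoidAlgebra.mapDomain_single, MonoidAlgebra.mapDomain_single]
      conv_lhs => rw [h2, ← smul_smul, MonoidAlgebra.single_smul_eq_self hp f.ker hker I hmem]
  have h2 : ∀ y : MonoidAlgebra A Δ, (∀ δ, y.coeff δ ∈ IsLocalRing.maximalIdeal A) →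
      MonoidAlgebra.mapDomain s y • v = 0 := by
    intro y hy
    rw [← MonoidAlgebra.sum_coeff_single y, MonoidAlgebra.mapDomain_sum, Finsupp.sum,
      Finset.sum_smul]
    refine Finset.sum_eq_zero fun δ _ => ?_
    have h3 : (MonoidAlgebra.single (s δ) (y.coeff δ) : MonoidAlgebra A Γ) =
        MonoidAlgebra.single (s δ) 1 * MonoidAlgebra.single 1 (y.coeff δ) := by
      simp [MonoidAlgebra.single_mul_single]
    rw [MonoidAlgebra.mapDomain_single, h3, ← smul_smul,
      MonoidAlgebra.single_one_smul_eq_zero I (hy δ), smul_zero]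
  have h3 : x • v = 0 := by
    rw [h1]
    refine h2 _ fun δ => ?_
    have := congrArg (fun z => MonoidAlgebra.coeff z δ) hx
    rw [MonoidAlgebra.coeff_mapRingHom] at this
    exact (IsLocalRing.residue_eq_zero_iff _).1 this
  rwa [← Submodule.Quotient.mk_smul, smul_eq_mul, mul_one, Submodule.Quotient.mk_eq_zero] at h3

end Radical

/-- The radical provides left inverses only, but the left inverse of `1 + x` is again `1` plus a
radical element, so it has a left inverse itself. -/
theorem Ring.isUnit_one_add_of_mem_jacobson {R : Type*} [Ring R] {x : R}
    (hx : x ∈ Ring.jacobson R) : IsUnit (1 + x) := by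
  have key : ∀ y ∈ Ring.jacobson R, ∃ z, z * (1 + y) = 1 := fun y hy => by
    rw [← Ideal.jacobson_bot] at hy
    obtain ⟨z, hz⟩ := Ideal.exists_mul_sub_mem_of_sub_one_mem_jacobson (1 + y) (by simpa using hy)
    exact ⟨z, sub_eq_zero.1 hz⟩
  obtain ⟨z, hz⟩ := key x hx
  have hz' : z = 1 + -(z * x) := by
    rw [← sub_eq_add_neg, eq_sub_iff_add_eq]
    rwa [mul_add, mul_one] at hz
  obtain ⟨w, hw⟩ := key (-(z * x)) (neg_mem (Ideal.mul_mem_left _ _ hx))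
  rw [← hz'] at hw
  have : w = 1 + x := left_inv_eq_right_inv hw hz
  exact ⟨⟨1 + x, z, this ▸ hw, hz⟩, rfl⟩

/-! ### The topology of a completed group algebra -/

section Topology

variable {A : Type u} [CommRing A] [TopologicalSpace A] {Γ : Type v}

/-- The topology of coefficientwise convergence on a group algebra. -/
abbrev MonoidAlgebra.coeffTopology (A : Type u) [CommRing A] [TopologicalSpace A] (Γ : Type v) :
    TopologicalSpace (MonoidAlgebra A Γ) :=
  .induced (fun x γ => x.coeff γ) inferInstance

attribute [local instance] MonoidAlgebra.coeffTopology

theorem MonoidAlgebra.continuous_iff_coeff {X : Type*} [TopologicalSpace X]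
    {f : X → MonoidAlgebra A Γ} : Continuous f ↔ ∀ γ, Continuous fun x => (f x).coeff γ := by
  exact continuous_induced_rng.trans continuous_pi_iff

theorem MonoidAlgebra.continuous_coeff (γ : Γ) :
    Continuous fun x : MonoidAlgebra A Γ => x.coeff γ :=
  MonoidAlgebra.continuous_iff_coeff.1 continuous_id γ

theorem MonoidAlgebra.continuous_single (γ : Γ) :
    Continuous fun a : A => (MonoidAlgebra.single γ a : MonoidAlgebra A Γ) := by
  classical
  refine MonoidAlgebra.continuous_iff_coeff.2 fun δ => ?_
  by_cases h : γ = δ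
  · subst h
    simpa using continuous_id'
  · simpa [Finsupp.single_apply, h] using continuous_const

theorem MonoidAlgebra.isEmbedding_coeff :
    Topology.IsEmbedding fun (x : MonoidAlgebra A Γ) (γ : Γ) => x.coeff γ :=
  ⟨⟨rfl⟩, fun _ _ h => MonoidAlgebra.coeff_injective (DFunLike.coe_injective h)⟩

theorem MonoidAlgebra.t2Space [T2Space A] : T2Space (MonoidAlgebra A Γ) :=
  MonoidAlgebra.isEmbedding_coeff.t2Space

theorem MonoidAlgebra.compactSpace [Finite Γ] [CompactSpace A] :
    CompactSpace (MonoidAlgebra A Γ) :=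
  ((Equiv.toHomeomorphOfIsInducing (MonoidAlgebra.coeffEquiv.trans Finsupp.equivFunOnFinite)
    MonoidAlgebra.isEmbedding_coeff.isInducing).symm).compactSpace

theorem MonoidAlgebra.isTopologicalRing [Group Γ] [Finite Γ] [IsTopologicalRing A] :
    IsTopologicalRing (MonoidAlgebra A Γ) := by
  have := Fintype.ofFinite Γ
  have hadd : ContinuousAdd (MonoidAlgebra A Γ) := ⟨MonoidAlgebra.continuous_iff_coeff.2 fun γ =>
    ((MonoidAlgebra.continuous_coeff γ).comp continuous_fst).add
      ((MonoidAlgebra.continuous_coeff γ).comp continuous_snd)⟩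
  have hneg : ContinuousNeg (MonoidAlgebra A Γ) := ⟨MonoidAlgebra.continuous_iff_coeff.2 fun γ =>
    (MonoidAlgebra.continuous_coeff γ).neg⟩
  have hmul : ContinuousMul (MonoidAlgebra A Γ) := by
    constructor
    have : (fun x : MonoidAlgebra A Γ × MonoidAlgebra A Γ => x.1 * x.2) = fun x =>
        ∑ γ, ∑ δ, MonoidAlgebra.single (γ * δ) (x.1.coeff γ * x.2.coeff δ) := by
      funext x
      conv_lhs => rw [← MonoidAlgebra.sum_single_coeff x.1, ← MonoidAlgebra.sum_single_coeff x.2]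
      simp only [Finset.sum_mul_sum, MonoidAlgebra.single_mul_single]
    rw [this]
    exact continuous_finsetSum _ fun γ _ => continuous_finsetSum _ fun δ _ =>
      (MonoidAlgebra.continuous_single _).comp
        (((MonoidAlgebra.continuous_coeff γ).comp continuous_fst).mul
          ((MonoidAlgebra.continuous_coeff δ).comp continuous_snd))
  exact {}

theorem MonoidAlgebra.continuous_mapDomainRingHom [Group Γ] [Finite Γ] [IsTopologicalRing A] {Δ : Type*}
    [Group Δ] [Finite Δ] (f : Γ →* Δ) : Continuous (MonoidAlgebra.mapDomainRingHom A f) := by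
  have := Fintype.ofFinite Γ
  have := MonoidAlgebra.isTopologicalRing (A := A) (Γ := Δ)
  have h : (MonoidAlgebra.mapDomainRingHom A f : MonoidAlgebra A Γ → MonoidAlgebra A Δ) = fun x =>
      ∑ γ, MonoidAlgebra.single (f γ) (x.coeff γ) := by
    funext x
    conv_lhs => rw [← MonoidAlgebra.sum_single_coeff x]
    simp [map_sum]
  rw [h]
  exact continuous_finsetSum _ fun γ _ =>
    (MonoidAlgebra.continuous_single _).comp (MonoidAlgebra.continuous_coeff γ)

variable {G : Type v} [Group G] [TopologicalSpace G]

theorem CompletedGroupAlgebra.isClosed [∀ N : OpenNormalSubgroup G, Finite (G ⧸ N.toSubgroup)]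
    [IsTopologicalRing A] [T2Space A] :
    IsClosed (CompletedGroupAlgebra A G :
      Set (∀ N : OpenNormalSubgroup G, MonoidAlgebra A (G ⧸ N.toSubgroup))) := by
  have := fun N : OpenNormalSubgroup G => MonoidAlgebra.t2Space (A := A) (Γ := G ⧸ N.toSubgroup)
  have h : (CompletedGroupAlgebra A G :
      Set (∀ N : OpenNormalSubgroup G, MonoidAlgebra A (G ⧸ N.toSubgroup))) =
      ⋂ (N : OpenNormalSubgroup G) (M : OpenNormalSubgroup G) (h : N.toSubgroup ≤ M.toSubgroup),
        {x | MonoidAlgebra.mapDomainRingHom A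
          (QuotientGroup.map N.toSubgroup M.toSubgroup (MonoidHom.id G) h) (x N) = x M} := by
    ext x
    simp only [Set.mem_iInter]
    rfl
  rw [h]
  exact isClosed_iInter fun N => isClosed_iInter fun M => isClosed_iInter fun h =>
    isClosed_eq ((MonoidAlgebra.continuous_mapDomainRingHom _).comp (continuous_apply N))
      (continuous_apply M)

/-- Idempotent matrices lift along the augmentation map of a completed group algebra over a compact
local ring with open maximal ideal. -/
theorem CompletedGroupAlgebra.liftsMatrixIdempotents [IsLocalRing A]
    [∀ N : OpenNormalSubgroup G, Finite (G ⧸ N.toSubgroup)]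
    [IsTopologicalRing A] [T2Space A] [CompactSpace A]
    (hA : IsOpen (IsLocalRing.maximalIdeal A : Set A)) (H : OpenNormalSubgroup G)
    (hH : Function.Surjective (augmentationMap A H)) :
    LiftsMatrixIdempotents (augmentationMap A H) := by
  have := fun N : OpenNormalSubgroup G => MonoidAlgebra.t2Space (A := A) (Γ := G ⧸ N.toSubgroup)
  have := fun N : OpenNormalSubgroup G =>
    MonoidAlgebra.compactSpace (A := A) (Γ := G ⧸ N.toSubgroup)
  have := fun N : OpenNormalSubgroup G =>
    MonoidAlgebra.isTopologicalRing (A := A) (Γ := G ⧸ N.toSubgroup)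
  have : CompactSpace (CompletedGroupAlgebra A G) :=
    isCompact_iff_compactSpace.1 CompletedGroupAlgebra.isClosed.isCompact
  refine liftsMatrixIdempotents_of_compactSpace hH fun s => ?_
  -- An open subgroup is closed, so the translates of the maximal ideal are closed.
  have hres : ∀ c : IsLocalRing.ResidueField A, IsClosed {a : A | IsLocalRing.residue A a = c} := by
    intro c
    obtain ⟨b, rfl⟩ := IsLocalRing.residue_surjective c
    have hcl : IsClosed (IsLocalRing.maximalIdeal A : Set A) :=
      (IsLocalRing.maximalIdeal A).toAddSubgroup.isClosed_of_isOpen hA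
    have : {a : A | IsLocalRing.residue A a = IsLocalRing.residue A b} =
        (fun a => a - b) ⁻¹' (IsLocalRing.maximalIdeal A : Set A) := by
      ext a
      rw [Set.mem_preimage, SetLike.mem_coe, ← IsLocalRing.residue_eq_zero_iff, map_sub,
        sub_eq_zero]
      rfl
    rw [this]
    exact hcl.preimage (continuous_id.sub continuous_const)
  have h : {x : CompletedGroupAlgebra A G | augmentationMap A H x = s} =
      ⋂ γ, (fun x : CompletedGroupAlgebra A G => (x.1 H).coeff γ) ⁻¹'
        {a | IsLocalRing.residue A a = s.coeff γ} := by
    ext x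
    simp only [Set.mem_iInter, Set.mem_preimage, Set.mem_ofPred_eq]
    constructor
    · rintro rfl γ
      exact (MonoidAlgebra.coeff_mapRingHom _ _ _).symm
    · intro hx
      ext γ
      exact (MonoidAlgebra.coeff_mapRingHom _ _ _).trans (hx γ)
  rw [h]
  exact isClosed_iInter fun γ => (hres _).preimage
    ((MonoidAlgebra.continuous_coeff γ).comp ((continuous_apply H).comp continuous_subtype_val))

end Topology

/-! ### The augmentation map -/

section Augmentation

variable {A : Type u} [CommRing A] [IsLocalRing A] {G : Type v} [Group G] [TopologicalSpace G]

theorem augmentationMap_surjective (H : OpenNormalSubgroup G) :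
    Function.Surjective (augmentationMap A H) := by
  intro y
  induction y using MonoidAlgebra.induction_linear with
  | zero => exact ⟨0, map_zero _⟩
  | add x y hx hy =>
    obtain ⟨x, rfl⟩ := hx
    obtain ⟨y, rfl⟩ := hy
    exact ⟨x + y, map_add _ _ _⟩
  | single γ c =>
    obtain ⟨g, rfl⟩ := QuotientGroup.mk_surjective γ
    obtain ⟨a, rfl⟩ := IsLocalRing.residue_surjective c
    exact ⟨⟨fun N => MonoidAlgebra.single (g : G ⧸ N.toSubgroup) a, fun N M h =>
      MonoidAlgebra.mapDomain_single⟩, MonoidAlgebra.mapRingHom_single _ _ _⟩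

/-- The kernel of the augmentation map is contained in the Jacobson radical if the subgroup that is
divided out is pro-`p`. -/
theorem ker_augmentationMap_le_jacobson [∀ N : OpenNormalSubgroup G, Finite (G ⧸ N.toSubgroup)]
    [Finite (IsLocalRing.ResidueField A)] {p : ℕ} [Fact p.Prime]
    (hp : (p : A) ∈ IsLocalRing.maximalIdeal A) (H : OpenNormalSubgroup G)
    (hH : IsProP p H.toSubgroup) :
    RingHom.ker (augmentationMap A H) ≤ Ring.jacobson (CompletedGroupAlgebra A G) := by
  have hunit : ∀ w ∈ RingHom.ker (augmentationMap A H), ∀ N : OpenNormalSubgroup G,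
      IsUnit (1 + w.1 N) := by
    intro w hw N
    -- `G/M` maps onto both `G/N` and `G/H`, and the kernel `H/M` of the second map is a `p`-group.
    let M : OpenNormalSubgroup G := N ⊓ H
    have hMN : M.toSubgroup ≤ N.toSubgroup := fun x hx => hx.1
    have hMH : M.toSubgroup ≤ H.toSubgroup := fun x hx => hx.2
    have hwM : w.1 M ∈ Ring.jacobson (MonoidAlgebra A (G ⧸ M.toSubgroup)) := by
      refine MonoidAlgebra.mem_jacobson_of_map_eq_zero hp
        (QuotientGroup.map M.toSubgroup H.toSubgroup (MonoidHom.id G) hMH) ?_ ?_ ?_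
      · exact QuotientGroup.map_surjective_of_surjective _ _ _ QuotientGroup.mk_surjective _
      · let M' : OpenNormalSubgroup H.toSubgroup :=
          { toSubgroup := M.toSubgroup.subgroupOf H.toSubgroup
            isOpen' := M.isOpen'.preimage continuous_subtype_val }
        obtain ⟨n, hn⟩ := hH.index_eq M'
        intro ⟨x, hx⟩
        obtain ⟨g, rfl⟩ := QuotientGroup.mk_surjective x
        have hg : g ∈ H.toSubgroup := (QuotientGroup.eq_one_iff g).1 hx
        refine ⟨n, Subtype.ext ((QuotientGroup.eq_one_iff _).2 ?_)⟩
        have : (⟨g, hg⟩ : H.toSubgroup) ^ p ^ n ∈ M'.toSubgroup := by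
          rw [← hn]
          exact M'.toSubgroup.pow_index_mem _
        exact this
      · rw [w.2 M H hMH]
        exact hw
    have := (Ring.isUnit_one_add_of_mem_jacobson hwM).map (MonoidAlgebra.mapDomainRingHom A
      (QuotientGroup.map M.toSubgroup N.toSubgroup (MonoidHom.id G) hMN))
    rwa [map_add, map_one, w.2 M N hMN] at this
  intro x hx
  rw [← Ideal.jacobson_bot, Ideal.mem_jacobson_iff]
  intro y
  have hw := hunit (y * x) (Ideal.mul_mem_left _ y hx)
  choose z hz using fun N => (hw N).exists_left_inv
  -- Inverses are unique, so those at the various levels are compatible and define an element of the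
  -- inverse limit.
  have hzc : z ∈ CompletedGroupAlgebra A G := by
    intro N M h
    have h1 := congrArg (MonoidAlgebra.mapDomainRingHom A
      (QuotientGroup.map N.toSubgroup M.toSubgroup (MonoidHom.id G) h)) (hz N)
    rw [map_mul, map_add, (y * x).2 N M h, map_one] at h1
    exact (hw M).mul_right_cancel (h1.trans (hz M).symm)
  refine ⟨⟨z, hzc⟩, (Submodule.mem_bot _).2 (Subtype.ext (funext fun N => ?_))⟩
  have := hz N
  rw [mul_add, mul_one] at this
  change z N * y.1 N * x.1 N + z N - 1 = 0
  rw [sub_eq_zero, ← this, add_comm, mul_assoc]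
  rfl

end Augmentation

theorem mainTheorem7 (p : ℕ) [Fact p.Prime]
    (K : Type u) [NormedField K] [IsUltrametricDist K] [NormedAlgebra ℚ_[p] K]
    [FiniteDimensional ℚ_[p] K]
    (G : Type v) [Group G] [TopologicalSpace G] [IsTopologicalGroup G] [CompactSpace G]
    (hG : IsPadicAnalyticGroup p G)
    (H : OpenNormalSubgroup G) (hH : IsUniformProP p H.toSubgroup)
    (hK : IsSplittingFieldFor K (G ⧸ H.toSubgroup)) :
    Function.Surjective (augmentationMap (IntegerRing K) H) ∧
    RingHom.ker (augmentationMap (IntegerRing K) H) ≤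
      Ring.jacobson (CompletedGroupAlgebra (IntegerRing K) G) ∧
    (∀ Q : FGProjective (MonoidAlgebra (IntegerResidueField K) (G ⧸ H.toSubgroup)),
      ∃ P : FGProjective (CompletedGroupAlgebra (IntegerRing K) G),
        IsReduction (augmentationMap (IntegerRing K) H) P Q) ∧
    (∃ e : K0 (CompletedGroupAlgebra (IntegerRing K) G) ≃+
        K0 (MonoidAlgebra (IntegerResidueField K) (G ⧸ H.toSubgroup)),
      ∀ (P : FGProjective (CompletedGroupAlgebra (IntegerRing K) G))
        (Q : FGProjective (MonoidAlgebra (IntegerResidueField K) (G ⧸ H.toSubgroup))),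
        IsReduction (augmentationMap (IntegerRing K) H) P Q → e (K0.mk P) = K0.mk Q) ∧
    Nonempty (K0 (MonoidAlgebra (IntegerResidueField K) (G ⧸ H.toSubgroup)) ≃+
      (Fin (numPRegularClasses p (G ⧸ H.toSubgroup)) → ℤ)) ∧
    Nonempty (K0 (CompletedGroupAlgebra (IntegerRing K) G) ≃+
      (Fin (numPRegularClasses p (G ⧸ H.toSubgroup)) → ℤ)) := by
  have hfin : ∀ N : OpenNormalSubgroup G, Finite (G ⧸ N.toSubgroup) := fun N =>
    Subgroup.quotient_finite_of_isOpen N.toSubgroup N.isOpen'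
  have : ProperSpace K := FiniteDimensional.proper ℚ_[p] K
  have : CharZero K := charZero_of_injective_algebraMap (algebraMap ℚ_[p] K).injective
  have := compactSpace_integerRing K
  have := finite_integerResidueField K
  have := isPrincipalIdealRing_integerRing K
  have hp : ((p : ℕ) : IntegerRing K) ∈ IsLocalRing.maximalIdeal (IntegerRing K) := by
    rw [mem_maximalIdeal_integerRing_iff]
    have : ((p : IntegerRing K) : K) = algebraMap ℚ_[p] K p := by simp
    rw [this, norm_algebraMap', Padic.norm_p]
    exact inv_lt_one_of_one_lt₀ (by exact_mod_cast (Fact.out : p.Prime).one_lt)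
  have hp' : (p : IntegerResidueField K) = 0 := by
    rw [← map_natCast (IsLocalRing.residue (IntegerRing K)), IsLocalRing.residue_eq_zero_iff]
    exact hp
  have : CharP (IntegerResidueField K) p :=
    (CharP.charP_iff_prime_eq_zero Fact.out).2 hp'
  have hunit : ∀ m : ℕ, m.Coprime p → IsUnit (m : IntegerRing K) := by
    intro m hm
    rw [← IsLocalRing.residue_ne_zero_iff_isUnit, map_natCast, Ne,
      CharP.cast_eq_zero_iff (IntegerResidueField K) p]
    exact fun h => (Nat.Prime.coprime_iff_not_dvd Fact.out).1 hm.symm h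
  have hsurj := augmentationMap_surjective (A := IntegerRing K) H
  have hker := ker_augmentationMap_le_jacobson hp H hH.isProP
  have hlift := CompletedGroupAlgebra.liftsMatrixIdempotents
    (isOpen_maximalIdeal_integerRing K) H hsurj
  obtain ⟨e, he⟩ := K0.exists_equiv_of_reduction hsurj hker hlift
  -- The splitting hypothesis on `K` enters here, as conjugacy of `g` and `g ^ q` for `p`-regular
  -- `g`.
  obtain ⟨ε⟩ := nonempty_K0_monoidAlgebra_equiv (k := IntegerResidueField K) (p := p)
    (A := G ⧸ H.toSubgroup) fun g hg => hK.isConj_pow (IntegerRing K) g (hunit _ hg)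
  exact ⟨hsurj, hker, exists_isReduction_lift hsurj hlift, ⟨e, he⟩, ⟨ε⟩, ⟨e.trans ε⟩⟩
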